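/- **Conventions.** All pseudofunctors into $\mathbf{Cat}$ take values in small categories. For a pseudofunctor $\mathbb E:\mathcal C^{\mathrm{op}}\to\mathbf{Cat}$, let $p_{\mathbb E}:\mathcal G(\mathbb E)\to\mathcal C$ be its Grothendieck construction: objects are pairs $(X,U)$ with $U\in\mathbb E(X)$, and an arrow $(Y,V)\to(X,U)$ is a pair $(y,a)$ with $y:Y\to X$ in $\mathcal C$ and $a:V\to\mathbb E(y)(U)$ in $\mathbb E(Y)$. For a functor $p:\mathcal P\to\mathcal C$, an arrow $f:A\to B$ of $\mathcal P$ is *cartesian* if for all $h:Z\to B$ and $g:p(Z)\to p(A)$ with $p(h)=p(f)g$ there is a unique $k:Z\to A$ with $p(k)=g$ and $fk=h$; an arrow is *vertical* if its image under $p$ is invertible. $p$ is a *(Street) fibration* if for all $A\in\mathcal P$ and $x:X\to p(A)$ there are a cartesian arrow $f:B\to A$ and an isomorphism $\theta:X\cong p(B)$ with $p(f)\theta=x$. A morphism of fibrations $[p]\to[q]$ over $\mathcal C$ is a functor $G$ preserving cartesian arrows together with a natural isomorphism $\varphi:q G\cong p$; a 2-cell $(G,\varphi)\Rightarrow(G',\varphi')$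 is a natural transformation $\alpha:G\Rightarrow G'$ with $\varphi'(q\alpha)=\varphi$. A functor $K:\mathcal A\to\mathcal B$ *is a localization* of $\mathcal A$ at a class of arrows $S$ if it inverts $S$ and the induced functor $\mathcal A[S^{-1}]\to\mathcal B$ is an equivalence. Let $F:\mathcal C\to\mathcal D$ be a functor. **(i) Indexed form.** Assume that $\mathcal C$ is small and $\mathcal D$ is locally small, and let $F^*\mathbb M:=\mathbb M\circ F^{\mathrm{op}}$ for a pseudofunctor $\mathbb M:\mathcal D^{\mathrm{op}}\to\mathbf{Cat}$. Let $\mathbb E:\mathcal C^{\mathrm{op}}\to\mathbf{Cat}$ be a pseudofunctor. Then $\mathbb E$ has an *inverse image* $\mathrm{Lan}_{F^{\mathrm{op}}}(\mathbb E)$, i.e. there are a pseudofunctor $\mathbb L:\mathcal D^{\mathrm{op}}\to\mathbf{Cat}$ and a pseudonatural transformation $\eta:\mathbb E\Rightarrow F^*\mathbb L$ such that for every pseudofunctor $\mathbb M:\mathcal D^{\mathrm{op}}\to\mathbf{Cat}$ the functor $\beta\mapsto F^*(\beta)\circ\eta$, from the category of pseudonatural transformations $\mathbb L\Rightarrow\mathbb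 M$ and modifications to the category of pseudonatural transformations $\mathbb E\Rightarrow F^*\mathbb M$ and modifications, is an equivalence. Moreover, for every such $(\mathbb L,\eta)$ and every object $D$ of $\mathcal D$, the functor $$(D\downarrow F\circ p_{\mathbb E})\to\mathbb L(D),\qquad [d:D\to F(X),\ U\in\mathbb E(X)]\mapsto \mathbb L(d)(\eta_X(U)),$$ is a localization of $(D\downarrow F\circ p_{\mathbb E})$ at the class $S_D$ of the arrows whose component $(y,a)$ in $\mathcal G(\mathbb E)$ is cartesian; that is, $$\mathrm{Lan}_{F^{\mathrm{op}}}(\mathbb E)(D)\simeq(D\downarrow F\circ p_{\mathbb E})[S_D^{-1}].$$ Here the objects of $(D\downarrow F\circ p_{\mathbb E})$ are the arrows $d:D\to F(X)$ with $(X,U)\in\mathcal G(\mathbb E)$, and a morphism from $d':D\to F(Y)$, with $(Y,V)\in\mathcal G(\mathbb E)$, to $d$ is an arrow $(y,a):(Y,V)\to(X,U)$ of $\mathcal G(\mathbb E)$ with $F(y)d'=d$. **(ii) Fibred form.** ($\mathcal C$ and $\mathcal D$ arbitrary.) Let $p:\mathcal P\to\mathcal C$ be a fibration. For a fibration $q:\mathcal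 Q\to\mathcal D$ let $F^*[q]$ be the projection to $\mathcal C$ of the pseudopullback of $q$ along $F$, whose objects are triples $(X,V,F(X)\cong q(V))$. Let $r:(1_{\mathcal D}\downarrow F\circ p)\to\mathcal D$ be the fibration of generalized elements of $F\circ p$: its objects are the arrows $d:D\to Fp(U)$, a morphism from $d':D'\to Fp(V)$ to $d$ is a pair $(e:D'\to D,\ \alpha:V\to U)$ with $Fp(\alpha)d'=d e$, and $r$ sends $(e,\alpha)$ to $e$. Let $S$ be the class of the arrows $(e,\alpha)$ that are $r$-vertical and for which $\alpha$ is cartesian in $\mathcal P$. Then $r$ inverts $S$. Let $K:(1_{\mathcal D}\downarrow F\circ p)\to\mathcal R$ be any localization at $S$, and let $\ell:\mathcal R\to\mathcal D$ be a functor with a natural isomorphism $\ell K\cong r$. Then $\ell$ is a fibration, $K$ preserves cartesian arrows, the functor $\eta$ over $\mathcal C$ sending $U$ to $(p(U),\,K(1_{Fp(U)}),\,Fp(U)\cong\ell K(1_{Fp(U)}))$ is a morphism of fibrations $[p]\to F^*[\ell]$, and for every fibration $q$ over $\mathcal D$ the functor $\beta\mapsto F^*(\beta)\circ\eta$, from the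 category of morphisms of fibrations $[\ell]\to[q]$ to that of morphisms of fibrations $[p]\to F^*[q]$, is an equivalence. That is, $[\ell]$ with unit $\eta$ is the inverse image of $[p]$: $$\mathrm{Lan}_{F^{\mathrm{op}}}([p])\simeq(1_{\mathcal D}\downarrow F\circ p)[S^{-1}].$$ -/

import Mathlib

open CategoryTheory Opposite Bicategory Limits
open scoped CategoryTheory.Pseudofunctor.StrongTrans

universe w v₁ v₂ v₃ v₄ v₅ u₁ u₂ u₃ u₄ u₅

namespace InverseImage

/-- An arrow `f` of the total category of a functor `p` is cartesian: every `h` with the same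
target and every factorization of `p h` through `p f` lift to a unique factorization of `h`
through `f`. -/
def IsCart {P : Type u₃} [Category.{v₃} P] {C : Type u₁} [Category.{v₁} C] (p : P ⥤ C) {a b : P}
    (f : a ⟶ b) : Prop :=
  p.IsStronglyCartesian (p.map f) f

section Indexed

universe w₁ w₂ w₃
variable {B : Type u₁} [Bicategory.{w₁, v₁} B] {B' : Type u₂} [Bicategory.{w₂, v₂} B']
  {K : Type u₃} [Bicategory.{w₃, v₃} K]

/-- Precomposition (whiskering) of a pseudonatural transformation with a pseudofunctor. -/
def precompTrans (P : B ⥤ᵖ B') {G H : B' ⥤ᵖ K} (β : G ⟶ H) : P.comp G ⟶ P.comp H where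
  app X := β.app (P.obj X)
  naturality f := β.naturality (P.map f)
  naturality_naturality η := β.naturality_naturality (P.map₂ η)
  naturality_id X := by
    have h₁ := β.naturality_naturality (P.mapId X).hom
    have h₂ := β.naturality_id (P.obj X)
    change (β.naturality (P.map (𝟙 X))).hom ≫ β.app (P.obj X) ◁
      (H.map₂ (P.mapId X).hom ≫ (H.mapId (P.obj X)).hom) =
      (G.map₂ (P.mapId X).hom ≫ (G.mapId (P.obj X)).hom) ▷ β.app (P.obj X) ≫ _
    rw [Bicategory.whiskerLeft_comp, Bicategory.comp_whiskerRight, ← Category.assoc, ← h₁,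
      Category.assoc, h₂]
    exact (Category.assoc _ _ _).symm
  naturality_comp {X Y Z} f g := by
    have h₁ := β.naturality_naturality (P.mapComp f g).hom
    have h₂ := β.naturality_comp (P.map f) (P.map g)
    change (β.naturality (P.map (f ≫ g))).hom ≫ β.app (P.obj X) ◁
      (H.map₂ (P.mapComp f g).hom ≫ (H.mapComp (P.map f) (P.map g)).hom) =
      (G.map₂ (P.mapComp f g).hom ≫ (G.mapComp (P.map f) (P.map g)).hom) ▷ β.app (P.obj Z) ≫ _
    rw [Bicategory.whiskerLeft_comp, Bicategory.comp_whiskerRight, ← Category.assoc, ← h₁,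
      Category.assoc, h₂]
    exact (Category.assoc _ _ _).symm

/-- Precomposition with a pseudofunctor, on hom-categories. -/
def precompFunctor (P : B ⥤ᵖ B') (G H : B' ⥤ᵖ K) : (G ⟶ H) ⥤ (P.comp G ⟶ P.comp H) where
  obj β := precompTrans P β
  map m := ⟨{ app := fun X => m.as.app (P.obj X)
              naturality := fun f => m.as.naturality (P.map f) }⟩
  map_id _ := rfl
  map_comp _ _ := rfl

end Indexed

section
variable {C : Type u₁} [Category.{v₁} C] {D : Type u₂} [Category.{v₂} D]

/-- The direct image `F^* L = L ∘ F^op` of a `D`-indexed category `L` along `F : C ⥤ D`. -/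
def restrict (F : C ⥤ D) (L : LocallyDiscrete Dᵒᵖ ⥤ᵖ Cat.{w, w}) :
    LocallyDiscrete Cᵒᵖ ⥤ᵖ Cat.{w, w} :=
  F.op.toPseudofunctor.comp L

/-- The action of the direct image along `F` on the hom-categories of indexed categories. -/
def restrictFunctor (F : C ⥤ D) (L M : LocallyDiscrete Dᵒᵖ ⥤ᵖ Cat.{w, w}) :
    (L ⟶ M) ⥤ (restrict F L ⟶ restrict F M) :=
  precompFunctor F.op.toPseudofunctor L M

/-- The pair `(L, η)` exhibits the `D`-indexed category `L` as the inverse image `Lan_{F^op}(E)` of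
the `C`-indexed category `E`, i.e. as the value at `E` of a left 2-adjoint of the direct image
`F^*`, with unit component `η : E ⟶ F^* L`: for every `D`-indexed category `M` the functor
`β ↦ F^*(β) ∘ η` from `Hom(L, M)` to `Hom(E, F^* M)` is an equivalence of categories. -/
def IsIndexedInverseImage (F : C ⥤ D) (E : LocallyDiscrete Cᵒᵖ ⥤ᵖ Cat.{w, w})
    (L : LocallyDiscrete Dᵒᵖ ⥤ᵖ Cat.{w, w}) (η : E ⟶ restrict F L) : Prop :=
  ∀ M : LocallyDiscrete Dᵒᵖ ⥤ᵖ Cat.{w, w},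
    (restrictFunctor F L M ⋙ Bicategory.precomp (restrict F M) η).IsEquivalence

theorem map₂_app (L : LocallyDiscrete Dᵒᵖ ⥤ᵖ Cat.{w, w}) {X Y : LocallyDiscrete Dᵒᵖ}
    {f g : X ⟶ Y} (η : f ⟶ g) (x : L.obj X) :
    (L.map₂ η).toNatTrans.app x =
      eqToHom (by rw [LocallyDiscrete.eq_of_hom η]) := by
  obtain rfl := LocallyDiscrete.eq_of_hom η
  obtain rfl : η = 𝟙 f := Subsingleton.elim _ _
  rw [L.map₂_id]
  rfl

open Pseudofunctor Pseudofunctor.CoGrothendieck in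
/-- The canonical functor from the Grothendieck construction of `F^* L` to that of `L`, sending
`(X, U)` to `(F X, U)`. -/
def restrictTotal (F : C ⥤ D) (L : LocallyDiscrete Dᵒᵖ ⥤ᵖ Cat.{w, w}) :
    ∫ᶜ (restrict F L) ⥤ ∫ᶜ L where
  obj a := ⟨F.obj a.base, a.fiber⟩
  map f := ⟨F.map f.base, f.fiber⟩
  map_id a := by
    refine CoGrothendieck.Hom.ext _ _ (F.map_id _) ?_
    exact congrArg (fun t => (L.mapId ⟨op (F.obj a.base)⟩).inv.toNatTrans.app a.fiber ≫ t)
      (map₂_app L (F.op.toPseudofunctor.mapId ⟨op a.base⟩).inv a.fiber)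
  map_comp {a b c} f g := by
    refine CoGrothendieck.Hom.ext _ _ (F.map_comp _ _) ?_
    refine (congrArg (fun t => f.fiber ≫ (L.map (F.map f.base).op.toLoc).toFunctor.map g.fiber ≫
      (L.mapComp (F.map g.base).op.toLoc (F.map f.base).op.toLoc).inv.toNatTrans.app c.fiber ≫ t)
      (map₂_app L (F.op.toPseudofunctor.mapComp g.base.op.toLoc f.base.op.toLoc).inv c.fiber)).trans
      ?_
    refine Eq.trans ?_ (Category.assoc _ _ _).symm
    exact congrArg (fun t => f.fiber ≫ t) (Category.assoc _ _ _).symm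

section
variable (L : LocallyDiscrete Dᵒᵖ ⥤ᵖ Cat.{w, w})

/-- The structural isomorphism `L(h) (L(y) x) ⟶ L(k) x` for composable `h`, `y` with composite
`k`. -/
def glue {X Y Z : D} (h : X ⟶ Y) (y : Y ⟶ Z) (k : X ⟶ Z) (hk : h ≫ y = k) (x : L.obj ⟨op Z⟩) :
    (L.map h.op.toLoc).toFunctor.obj ((L.map y.op.toLoc).toFunctor.obj x) ⟶
      (L.map k.op.toLoc).toFunctor.obj x :=
  (L.mapComp y.op.toLoc h.op.toLoc).inv.toNatTrans.app x ≫ eqToHom (by subst hk; rfl)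

theorem glue_rfl {X Y Z : D} (h : X ⟶ Y) (y : Y ⟶ Z) (x : L.obj ⟨op Z⟩) :
    glue L h y (h ≫ y) rfl x = (L.mapComp y.op.toLoc h.op.toLoc).inv.toNatTrans.app x :=
  Category.comp_id _

theorem glue_naturality {X Y Z : D} (h : X ⟶ Y) (y : Y ⟶ Z) (k : X ⟶ Z) (hk : h ≫ y = k)
    {x x' : L.obj ⟨op Z⟩} (f : x ⟶ x') :
    (L.map h.op.toLoc).toFunctor.map ((L.map y.op.toLoc).toFunctor.map f) ≫ glue L h y k hk x' =
      glue L h y k hk x ≫ (L.map k.op.toLoc).toFunctor.map f := by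
  subst hk
  rw [glue_rfl, glue_rfl]
  exact (L.mapComp y.op.toLoc h.op.toLoc).inv.toNatTrans.naturality f

theorem glue_id {X Y : D} (h : X ⟶ Y) (hk : h ≫ 𝟙 Y = h) (x : L.obj ⟨op Y⟩) :
    (L.map h.op.toLoc).toFunctor.map ((L.mapId ⟨op Y⟩).inv.toNatTrans.app x) ≫
      glue L h (𝟙 Y) h hk x = 𝟙 _ := by
  have h₁ := Pseudofunctor.mapComp_id_left_inv_app L h.op.toLoc x
  have h₂ : (L.map h.op.toLoc).toFunctor.map ((L.mapId ⟨op Y⟩).inv.toNatTrans.app x) ≫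
    (L.map h.op.toLoc).toFunctor.map ((L.mapId ⟨op Y⟩).hom.toNatTrans.app x) = 𝟙 _ := by
    rw [← Functor.map_comp, Cat.Hom.inv_hom_id_toNatTrans_app]
    exact CategoryTheory.Functor.map_id _ _
  have h₃ : glue L h (𝟙 Y) h hk x =
      (L.map h.op.toLoc).toFunctor.map ((L.mapId ⟨op Y⟩).hom.toNatTrans.app x) := by
    refine (congrArg (· ≫ _) (h₁.trans (congrArg (_ ≫ ·)
      (map₂_app L (λ_ h.op.toLoc).inv x)))).trans ?_
    refine (Category.assoc _ _ _).trans ((congrArg (_ ≫ ·) (eqToHom_trans _ _)).trans ?_)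
    exact Category.comp_id _
  exact (congrArg (_ ≫ ·) h₃).trans h₂

theorem glue_assoc {X Y Z W : D} (h : X ⟶ Y) (y : Y ⟶ Z) (z : Z ⟶ W) (k : X ⟶ Z) (hk : h ≫ y = k)
    (m : X ⟶ W) (hm : k ≫ z = m) (hm' : h ≫ y ≫ z = m) (x : L.obj ⟨op W⟩) :
    (L.map h.op.toLoc).toFunctor.map ((L.mapComp z.op.toLoc y.op.toLoc).inv.toNatTrans.app x) ≫
      glue L h (y ≫ z) m hm' x =
    glue L h y k hk ((L.map z.op.toLoc).toFunctor.obj x) ≫ glue L k z m hm x := by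
  subst hk hm
  have h₁ := Pseudofunctor.mapComp_assoc_left_inv_app L z.op.toLoc y.op.toLoc h.op.toLoc x
  rw [glue_rfl, glue_rfl]
  refine (Category.assoc _ _ _).symm.trans ((congrArg (· ≫ _) (h₁.trans (congrArg (_ ≫ ·)
    (congrArg (_ ≫ ·) (map₂_app L (α_ z.op.toLoc y.op.toLoc h.op.toLoc).inv x))))).trans ?_)
  refine (Category.assoc _ _ _).trans (congrArg (_ ≫ ·) ?_)
  refine (Category.assoc _ _ _).trans ((congrArg (_ ≫ ·) (eqToHom_trans _ _)).trans ?_)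
  exact Category.comp_id _
end

open Pseudofunctor Pseudofunctor.CoGrothendieck in
/-- The functor which sends an object `(x : d ⟶ Y, V)`, with `(Y, V)` in the Grothendieck
construction of `L`, to the restriction `L(x)(V)` in the fibre `L(d)`. -/
def evalTotal (L : LocallyDiscrete Dᵒᵖ ⥤ᵖ Cat.{w, w}) (d : D) :
    StructuredArrow d (forget L) ⥤ L.obj ⟨op d⟩ where
  obj a := (L.map a.hom.op.toLoc).toFunctor.obj a.right.fiber
  map {a b} f := (L.map a.hom.op.toLoc).toFunctor.map f.right.fiber ≫
    glue L a.hom f.right.base b.hom (StructuredArrow.w f) b.right.fiber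
  map_id a := glue_id L a.hom _ a.right.fiber
  map_comp {a b c} f g := by
    refine (congrArg (· ≫ _) (((L.map a.hom.op.toLoc).toFunctor.map_comp _ _).trans
      (congrArg (_ ≫ ·) ((L.map a.hom.op.toLoc).toFunctor.map_comp _ _)))).trans ?_
    refine (Category.assoc _ _ _).trans ?_
    refine Eq.trans ?_ (Category.assoc _ _ _).symm
    refine congrArg (_ ≫ ·) ?_
    refine (Category.assoc _ _ _).trans ?_
    refine (congrArg (_ ≫ ·) (glue_assoc L a.hom f.right.base g.right.base b.hom
      (StructuredArrow.w f) c.hom (StructuredArrow.w g) (StructuredArrow.w (f ≫ g)) _)).trans ?_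
    exact (Category.assoc _ _ _).symm.trans ((congrArg (· ≫ _) (glue_naturality L _ _ _ _ _)).trans
      (Category.assoc _ _ _))

open Pseudofunctor Pseudofunctor.CoGrothendieck in
/-- The comparison functor from `(d ↓ F ∘ p_E)` to the fibre `L(d)` induced by a pseudonatural
transformation `η : E ⟶ F^* L`: on objects it sends `(x : d ⟶ F X, U)` with `U` in `E(X)` to
`L(x)(η_X U)`. -/
def fibreComparison (F : C ⥤ D) {E : LocallyDiscrete Cᵒᵖ ⥤ᵖ Cat.{w, w}}
    {L : LocallyDiscrete Dᵒᵖ ⥤ᵖ Cat.{w, w}} (η : E ⟶ restrict F L) (d : D) :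
    StructuredArrow d (forget E ⋙ F) ⥤ L.obj ⟨op d⟩ :=
  StructuredArrow.pre d (CoGrothendieck.map η ⋙ restrictTotal F L) (forget L) ⋙ evalTotal L d

open Pseudofunctor Pseudofunctor.CoGrothendieck in
/-- The class of arrows of `(d ↓ F ∘ p_E)` whose component in the Grothendieck construction of `E`
is cartesian. -/
def fibreCart (F : C ⥤ D) (E : LocallyDiscrete Cᵒᵖ ⥤ᵖ Cat.{w, w}) (d : D) :
    MorphismProperty (StructuredArrow d (forget E ⋙ F)) :=
  fun _ _ f => IsCart (forget E) f.right

end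

section Fibrations
open CategoricalPullback
variable {C : Type u₁} [Category.{v₁} C] {D : Type u₂} [Category.{v₂} D]
  {P : Type u₃} [Category.{v₃} P] {Q : Type u₄} [Category.{v₄} Q]
  {R : Type u₅} [Category.{v₅} R]

theorem isCart_iff (p : P ⥤ C) {a b : P} (f : a ⟶ b) :
    IsCart p f ↔ ∀ (c : P) (h : c ⟶ b) (g : p.obj c ⟶ p.obj a), p.map h = g ≫ p.map f →
      ∃! k : c ⟶ a, p.map k = g ∧ k ≫ f = h := by
  constructor
  · intro hf c h g hg
    have : p.IsHomLift (g ≫ p.map f) h := hg ▸ inferInstance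
    obtain ⟨k, ⟨hk, hk'⟩, huniq⟩ := hf.universal_property' g h
    refine ⟨k, ⟨(IsHomLift.eq_of_isHomLift p g k).symm, hk'⟩, ?_⟩
    rintro k' ⟨h₁, h₂⟩
    exact huniq k' ⟨h₁ ▸ inferInstance, h₂⟩
  · intro H
    refine { universal_property' := ?_ }
    intro c g h hh
    obtain ⟨k, ⟨hk, hk'⟩, huniq⟩ := H c h g (IsHomLift.eq_of_isHomLift p (g ≫ p.map f) h).symm
    refine ⟨k, ⟨hk ▸ inferInstance, hk'⟩, ?_⟩
    rintro k' ⟨h₁, h₂⟩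
    exact huniq k' ⟨(IsHomLift.eq_of_isHomLift p g k').symm, h₂⟩

/-- Street fibrations: arrows into the image of an object have cartesian lifts up to an
isomorphism. -/
def IsStreetFibration (p : P ⥤ C) : Prop :=
  ∀ (a : P) (X : C) (x : X ⟶ p.obj a), ∃ (b : P) (f : b ⟶ a) (θ : X ≅ p.obj b),
    IsCart p f ∧ θ.hom ≫ p.map f = x

/-- Morphisms of fibrations over a fixed base: a functor preserving cartesian arrows together with
an invertible 2-cell over the base. -/
structure FibHom (p : P ⥤ C) (q : Q ⥤ C) where
  /-- the functor between total categories -/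
  functor : P ⥤ Q
  /-- the invertible 2-cell over the base -/
  iso : functor ⋙ q ≅ p
  preserves : ∀ {a b : P} (f : a ⟶ b), IsCart p f → IsCart q (functor.map f)

namespace FibHom

/-- 2-cells between morphisms of fibrations: natural transformations compatible with the
structural isomorphisms over the base. -/
@[ext]
structure Hom {p : P ⥤ C} {q : Q ⥤ C} (G H : FibHom p q) where
  /-- the underlying natural transformation -/
  nat : G.functor ⟶ H.functor
  w : ∀ a : P, q.map (nat.app a) ≫ H.iso.hom.app a = G.iso.hom.app a

instance {p : P ⥤ C} {q : Q ⥤ C} : Category (FibHom p q) where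
  Hom := Hom
  id G := ⟨𝟙 _, fun a => by simp⟩
  comp α β := ⟨α.nat ≫ β.nat, fun a => by simp [β.w, α.w]⟩
  id_comp _ := Hom.ext (Category.id_comp _)
  comp_id _ := Hom.ext (Category.comp_id _)
  assoc _ _ _ := Hom.ext (Category.assoc _ _ _)

/-- Composition of morphisms of fibrations. -/
def comp {p : P ⥤ C} {q : Q ⥤ C} {r : R ⥤ C} (G : FibHom p q) (H : FibHom q r) : FibHom p r where
  functor := G.functor ⋙ H.functor
  iso := Functor.associator _ _ _ ≪≫ Functor.isoWhiskerLeft G.functor H.iso ≪≫ G.iso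
  preserves f hf := H.preserves _ (G.preserves f hf)

/-- Precomposition with a morphism of fibrations, on hom-categories. -/
def precomp {p : P ⥤ C} {q : Q ⥤ C} (G : FibHom p q) (r : R ⥤ C) : FibHom q r ⥤ FibHom p r where
  obj H := G.comp H
  map {H H'} α := ⟨Functor.whiskerLeft G.functor α.nat, fun a => by
    have := α.w (G.functor.obj a)
    simp [comp, reassoc_of% this]⟩
  map_id _ := rfl
  map_comp _ _ := rfl

end FibHom

theorem isCart_of_snd (F : C ⥤ D) (q : Q ⥤ D) {a b : F ⊡ q} (f : a ⟶ b) (hf : IsCart q f.snd) :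
    IsCart (π₁ F q) f := by
  rw [isCart_iff] at hf ⊢
  intro c h (g : c.fst ⟶ a.fst) (hg : h.fst = g ≫ f.fst)
  have hq : q.map h.snd = (c.iso.inv ≫ F.map g ≫ a.iso.hom) ≫ q.map f.snd := by
    have h₁ := h.w
    have h₂ := f.w
    rw [hg, F.map_comp, Category.assoc, h₂] at h₁
    rw [← cancel_epi c.iso.hom, ← h₁]
    simp
  obtain ⟨k, ⟨hk, hk'⟩, huniq⟩ := hf c.snd h.snd _ hq
  refine ⟨⟨g, k, by simp [hk]⟩, ⟨rfl, hom_ext hg.symm hk'⟩, ?_⟩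
  rintro k' ⟨h₁, h₂⟩
  refine hom_ext h₁ (huniq _ ⟨?_, congrArg (fun t => t.snd) h₂⟩)
  have := k'.w
  rw [← cancel_epi c.iso.hom, ← this, show k'.fst = g from h₁]
  simp

theorem isCart_snd (F : C ⥤ D) {q : Q ⥤ D} (hq : IsStreetFibration q) {a b : F ⊡ q} (f : a ⟶ b)
    (hf : IsCart (π₁ F q) f) : IsCart q f.snd := by
  obtain ⟨B, t, θ, ht, hθ⟩ := hq b.snd _ (F.map f.fst ≫ b.iso.hom)
  let m : F ⊡ q := ⟨a.fst, B, θ⟩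
  let t' : m ⟶ b := ⟨f.fst, t, hθ.symm⟩
  have ht' : IsCart (π₁ F q) t' := isCart_of_snd F q t' ht
  obtain ⟨k, ⟨hk, hk'⟩, -⟩ := (isCart_iff _ _).1 ht' a f (𝟙 a.fst) (Category.id_comp _).symm
  obtain ⟨l, ⟨hl, hl'⟩, -⟩ := (isCart_iff _ _).1 hf m t' (𝟙 a.fst) (Category.id_comp _).symm
  have hkl : k ≫ l = 𝟙 a := by
    refine ((isCart_iff _ _).1 hf a f (𝟙 a.fst) (Category.id_comp _).symm).unique
      ⟨?_, ?_⟩ ⟨(π₁ F q).map_id a, Category.id_comp _⟩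
    · rw [Functor.map_comp, hk, hl]
      exact Category.id_comp _
    · rw [Category.assoc, hl', hk']
  have hlk : l ≫ k = 𝟙 m := by
    refine ((isCart_iff _ _).1 ht' m t' (𝟙 a.fst) (Category.id_comp _).symm).unique
      ⟨?_, ?_⟩ ⟨(π₁ F q).map_id m, Category.id_comp _⟩
    · rw [Functor.map_comp, hk, hl]
      exact Category.id_comp _
    · rw [Category.assoc, hk', hl']
  have hkl₂ : k.snd ≫ l.snd = 𝟙 a.snd := congrArg (fun t => t.snd) hkl
  have hlk₂ : l.snd ≫ k.snd = 𝟙 B := congrArg (fun t => t.snd) hlk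
  have hkt : k.snd ≫ t = f.snd := congrArg (fun t => t.snd) hk'
  rw [isCart_iff] at ht ⊢
  intro c h g hg
  obtain ⟨x, ⟨hx, hx'⟩, hu⟩ := ht c h (g ≫ q.map k.snd) (by
    rw [hg, Category.assoc, ← q.map_comp, hkt])
  refine ⟨x ≫ l.snd, ⟨?_, ?_⟩, ?_⟩
  · rw [q.map_comp, hx, Category.assoc, ← q.map_comp, hkl₂, q.map_id, Category.comp_id]
  · rw [← hkt, Category.assoc, ← Category.assoc l.snd, hlk₂, Category.id_comp, hx']
  · rintro y ⟨hy, hy'⟩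
    rw [← hu (y ≫ k.snd) ⟨by rw [q.map_comp, hy], by rw [Category.assoc, hkt, hy']⟩,
      Category.assoc, hkl₂, Category.comp_id]

/-- The direct image of a Street fibration is a Street fibration. -/
theorem IsStreetFibration.directImage (F : C ⥤ D) {q : Q ⥤ D} (hq : IsStreetFibration q) :
    IsStreetFibration (π₁ F q) := by
  intro a X (x : X ⟶ a.fst)
  obtain ⟨B, t, θ, ht, hθ⟩ := hq a.snd _ (F.map x ≫ a.iso.hom)
  exact ⟨⟨X, B, θ⟩, ⟨x, t, hθ.symm⟩, Iso.refl X, isCart_of_snd F q _ ht, Category.id_comp _⟩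

/-- The direct image of a fibration `q : Q ⥤ D` along `F : C ⥤ D` is the projection
`π₁ F q : F ⊡ q ⥤ C` of the pseudopullback; this is its action on morphisms of fibrations. -/
def directImageMap (F : C ⥤ D) {p : P ⥤ D} (hp : IsStreetFibration p) {q : Q ⥤ D}
    (β : FibHom p q) : FibHom (π₁ F p) (π₁ F q) where
  functor :=
    { obj := fun a => ⟨a.fst, β.functor.obj a.snd, a.iso ≪≫ (β.iso.app a.snd).symm⟩
      map := fun {a b} f => ⟨f.fst, β.functor.map f.snd, by
        have h₁ := f.w
        have h₂ := β.iso.inv.naturality f.snd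
        dsimp at h₂ ⊢
        rw [Category.assoc, ← h₂, reassoc_of% h₁]⟩
      map_id := fun a => hom_ext rfl (β.functor.map_id _)
      map_comp := fun f g => hom_ext rfl (β.functor.map_comp _ _) }
  iso := Iso.refl _
  preserves f hf := isCart_of_snd F q _ (β.preserves _ (isCart_snd F hp f hf))

/-- The direct image along `F`, on hom-categories. -/
def directImageFunctor (F : C ⥤ D) {p : P ⥤ D} (hp : IsStreetFibration p) (q : Q ⥤ D) :
    FibHom p q ⥤ FibHom (π₁ F p) (π₁ F q) where
  obj β := directImageMap F hp β
  map {β γ} α := ⟨{ app := fun a => ⟨𝟙 a.fst, α.nat.app a.snd, by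
                      have h : γ.iso.inv.app a.snd =
                          β.iso.inv.app a.snd ≫ q.map (α.nat.app a.snd) := by
                        rw [← cancel_mono (γ.iso.hom.app a.snd), Category.assoc, α.w]
                        simp
                      simp [directImageMap, h]⟩
                    naturality := fun a b f => hom_ext
                      ((Category.comp_id _).trans (Category.id_comp _).symm)
                      (α.nat.naturality f.snd) }, fun a => Category.comp_id _⟩
  map_id _ := rfl
  map_comp _ _ := FibHom.Hom.ext (NatTrans.ext (funext fun _ =>
    hom_ext (Category.comp_id _).symm rfl))

/-- The pair `(r, η)` exhibits the fibration `r : R ⥤ D` as the inverse image `Lan_{F^op}([p])` of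
`p : P ⥤ C`, i.e. as the value at `p` of a left 2-adjoint of the direct image `F^*` of fibrations,
with unit component `η : [p] ⟶ F^* [r]`: for every Street fibration `q : Q ⥤ D` the functor
`β ↦ F^*(β) ∘ η` from `Hom([r], [q])` to `Hom([p], F^* [q])` is an equivalence of categories. -/
def IsFibredInverseImage (F : C ⥤ D) {p : P ⥤ C} {r : R ⥤ D} (hr : IsStreetFibration r)
    (η : FibHom p (π₁ F r)) : Prop :=
  ∀ {Q : Type u₄} [Category.{v₄} Q] (q : Q ⥤ D), IsStreetFibration q →
    (directImageFunctor F hr q ⋙ η.precomp (π₁ F q)).IsEquivalence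

/-- The functor from `P` to the category `(1_D ↓ F ∘ p)` of generalized elements of `F ∘ p`,
sending `U` to `(F p U, U, 𝟙)`. -/
def idElt (p : P ⥤ C) (F : C ⥤ D) : P ⥤ Comma (𝟭 D) (p ⋙ F) where
  obj U := ⟨F.obj (p.obj U), U, 𝟙 _⟩
  map α := ⟨F.map (p.map α), α, (Category.comp_id _).trans (Category.id_comp _).symm⟩

/-- The class of arrows `(e, α)` of `(1_D ↓ F ∘ p)` that are vertical for the projection to `D`
(their image `e` is invertible) and whose component `α` in `P` is cartesian. -/
def vertCart (p : P ⥤ C) (F : C ⥤ D) : MorphismProperty (Comma (𝟭 D) (p ⋙ F)) :=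
  fun _ _ f => IsIso ((Comma.fst (𝟭 D) (p ⋙ F)).map f) ∧ IsCart p f.right

/-- For a functor `K` out of `(1_D ↓ F ∘ p)` and `r : R ⥤ D` with `r ∘ K` isomorphic to the
projection to `D`, the induced functor over `C` from `P` to the pseudopullback of `r` along `F`,
sending `U` to `(p U, K(F p U, U, 𝟙))`. -/
def unitFunctor (p : P ⥤ C) (F : C ⥤ D) (K : Comma (𝟭 D) (p ⋙ F) ⥤ R) (r : R ⥤ D)
    (e : K ⋙ r ≅ Comma.fst _ _) : P ⥤ F ⊡ r where
  obj U := ⟨p.obj U, K.obj ((idElt p F).obj U), (e.app ((idElt p F).obj U)).symm⟩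
  map α := ⟨p.map α, K.map ((idElt p F).map α), e.inv.naturality ((idElt p F).map α)⟩
  map_id U := hom_ext (p.map_id U) (((idElt p F) ⋙ K).map_id U)
  map_comp α β := hom_ext (p.map_comp α β) (((idElt p F) ⋙ K).map_comp α β)

/-- The functor `unitFunctor` lies over `C` strictly. -/
def unitIso (p : P ⥤ C) (F : C ⥤ D) (K : Comma (𝟭 D) (p ⋙ F) ⥤ R) (r : R ⥤ D)
    (e : K ⋙ r ≅ Comma.fst _ _) : unitFunctor p F K r e ⋙ π₁ F r ≅ p :=
  Iso.refl _

end Fibrations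

end InverseImage

/-!
# Inverse images of indexed categories and of fibrations as localizations

**Indexed form.** For a functor `H : P ⥤ D` and a class `W` of arrows of `P`, localizing every
comma category `(d ↓ H)` at the arrows with component in `W` gives a `D`-indexed category
`locIndexed H W`: reindexing is precomposition, so the coherence isomorphisms are represented by
identities of `P`. With `P` the Grothendieck construction of `E`, `H` its projection followed by `F`
and `W` the cartesian arrows, this is `lan F E`, with unit `lanUnit F E` sending `U` in `E(X)` to
the object represented by the identity of `F X`. A transformation `γ : E ⟶ F^* M` induces functors
`(d ↓ F ∘ p_E) ⥤ M(d)`, `(x, U) ↦ M(x)(γ U)`, which invert the arrows with cartesian component;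
their factorizations through the localizations form the transpose `transpose F γ : lan F E ⟶ M`.
Transposition is inverse, up to isomorphism, to `β ↦ F^*(β) ∘ η` (`restrictTransposeIso`,
`transposeRestrictIso`), because the object represented by `x : d ⟶ F X` is the reindexing along `x`
of the one represented by the identity of `F X`. This is `isIndexedInverseImage_lan`. Any other
inverse image `(L, η)` is equivalent to this one through the transpose of `η`, and the fibres of
that transpose, composed with the localization functors, are the comparison functors of the
statement (`IsIndexedInverseImage.isLocalization`).

**Fibred form.** For every `H` and `W` the Grothendieck construction of `locIndexed H W` is the
localization of `(1_D ↓ H)` at the arrows that are vertical with component in `W`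
(`isLocalization_toTotal`): an arrow of a Grothendieck construction is a vertical arrow followed by
a cartesian one, so a functor inverting those arrows extends fibre by fibre. Hence any localization
`K` over `D` is equivalent to a Grothendieck construction over `D`, sends the arrows `(y, 1)` to
cartesian arrows (`isCart_map_liftArrow`), and its codomain is a fibration.

For the universal property, the arrow `(d, 1)` from a generalized element `d : A ⟶ F p U` to the
generalized element `𝟙 (F p U)` becomes cartesian in the localization. Therefore a 2-cell between
morphisms of fibrations is determined by its restriction along the unit, and every 2-cell between
restrictions extends (`hom_ext_of_idElt`, `exists_hom_extending`). A morphism `γ : [p] ⟶ F^* [q]` is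
extended by sending `d : A ⟶ F p U` to a chosen cartesian lift in `q` of `d` with codomain the
component of `γ U` (`liftFunctor`), which inverts the class in question
(`liftFunctor_isInvertedBy`) and so descends to the localization.
-/

noncomputable section

namespace InverseImage

/-! ### Objectwise calculus of indexed categories -/

section Transposition

variable {A : Type u₁} [Category.{v₁} A] {B : Type u₂} [Category.{v₂} B] (G : A ⥤ B)

-- Diagram chases in an arbitrary category. They are applied by `exact` in the fibres of a
-- pseudofunctor, where rewriting is blocked because the fibres are categories only after `Cat`
-- is unfolded.

theorem map_comp_eq_of_eq_id {l : A} {m : B} (n : G.obj l ⟶ m) {u : l ⟶ l} {v : m ⟶ m}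
    (hu : u = 𝟙 l) (hv : v = 𝟙 m) : G.map u ≫ n = n ≫ v := by
  rw [hu, hv, G.map_id, Category.id_comp, Category.comp_id]

theorem transpose_unit {l l' : A} (i : l ≅ l') {m : B} (n : G.obj l ⟶ m) (j : m ≅ G.obj l')
    (h : G.map i.inv ≫ n = j.inv) : n ≫ j.hom = G.map i.hom ≫ 𝟙 _ ≫ 𝟙 _ := by
  rw [Category.comp_id, Category.comp_id, ← cancel_epi (G.map i.inv), ← Category.assoc, h,
    j.inv_hom_id, ← G.map_comp, i.inv_hom_id, G.map_id]

theorem transpose_comp {l l' : A} (i : l ≅ l') {m m' b : B} (n : G.obj l ⟶ m) (j : m ≅ m')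
    (p : G.obj l' ⟶ b) (q : b ⟶ m') (h : G.map i.inv ≫ n = p ≫ q ≫ j.inv) :
    n ≫ j.hom = G.map i.hom ≫ 𝟙 _ ≫ p ≫ 𝟙 _ ≫ q ≫ 𝟙 _ := by
  rw [Category.id_comp, Category.id_comp, Category.comp_id, ← cancel_epi (G.map i.inv),
    ← Category.assoc, h, ← Category.assoc (G.map i.inv), ← G.map_comp, i.inv_hom_id, G.map_id,
    Category.id_comp, Category.assoc, Category.assoc, j.inv_hom_id, Category.comp_id]

theorem transpose_square {a a' : B} (i : a ≅ a') {l l' : A} (j : l ≅ l') {d : a' ⟶ G.obj l'}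
    {c : a ⟶ G.obj l} (h : i.hom ≫ d = c ≫ G.map j.hom) : i.inv ≫ c = d ≫ G.map j.inv := by
  rw [i.inv_comp_eq, ← Category.assoc, h, Category.assoc, ← G.map_comp, j.hom_inv_id, G.map_id,
    Category.comp_id]

end Transposition

section Elementwise

variable {C : Type u₁} [Category.{v₁} C] {D : Type u₂} [Category.{v₂} D]
variable (L : LocallyDiscrete Dᵒᵖ ⥤ᵖ Cat.{w, w}) {M N : LocallyDiscrete Dᵒᵖ ⥤ᵖ Cat.{w, w}}

/-- Reindexing `L(Y) ⥤ L(X)` along `h : X ⟶ Y`. -/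
abbrev pull {X Y : D} (h : X ⟶ Y) : L.obj ⟨op Y⟩ ⥤ L.obj ⟨op X⟩ :=
  (L.map h.op.toLoc).toFunctor

/-- The structural isomorphism `x ⟶ L(k) x` for an arrow `k` equal to the identity. -/
def unitCell {X : D} (k : X ⟶ X) (hk : k = 𝟙 X) (x : L.obj ⟨op X⟩) : x ⟶ (pull L k).obj x :=
  (L.mapId ⟨op X⟩).inv.toNatTrans.app x ≫ eqToHom (by subst hk; rfl)

theorem unitCell_rfl {X : D} (x : L.obj ⟨op X⟩) :
    unitCell L (𝟙 X) rfl x = (L.mapId ⟨op X⟩).inv.toNatTrans.app x :=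
  Category.comp_id _

theorem unitCell_naturality {X : D} (k : X ⟶ X) (hk : k = 𝟙 X) {x x' : L.obj ⟨op X⟩}
    (f : x ⟶ x') : f ≫ unitCell L k hk x' = unitCell L k hk x ≫ (pull L k).map f := by
  subst hk
  rw [unitCell_rfl, unitCell_rfl]
  exact (L.mapId ⟨op X⟩).inv.toNatTrans.naturality f

instance isIso_unitCell {X : D} (k : X ⟶ X) (hk : k = 𝟙 X) (x : L.obj ⟨op X⟩) :
    IsIso (unitCell L k hk x) := by
  subst hk
  rw [unitCell_rfl]
  exact ((Cat.Hom.toNatIso (L.mapId ⟨op X⟩)).app x).isIso_inv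

instance isIso_glue {X Y Z : D} (h : X ⟶ Y) (y : Y ⟶ Z) (k : X ⟶ Z) (hk : h ≫ y = k)
    (x : L.obj ⟨op Z⟩) : IsIso (glue L h y k hk x) := by
  subst hk
  rw [glue_rfl]
  exact ((Cat.Hom.toNatIso (L.mapComp y.op.toLoc h.op.toLoc)).app x).isIso_inv

theorem map_unitCell_glue {X Y : D} (h : X ⟶ Y) (k : Y ⟶ Y) (hk : k = 𝟙 Y) (e : h ≫ k = h)
    (x : L.obj ⟨op Y⟩) :
    (pull L h).map (unitCell L k hk x) ≫ glue L h k h e x = 𝟙 _ := by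
  subst hk
  rw [unitCell_rfl]
  exact glue_id L h e x

theorem unitCell_glue {X Y : D} (k : X ⟶ X) (hk : k = 𝟙 X) (h : X ⟶ Y) (e : k ≫ h = h)
    (x : L.obj ⟨op Y⟩) :
    unitCell L k hk ((pull L h).obj x) ≫ glue L k h h e x = 𝟙 _ := by
  subst hk
  rw [unitCell_rfl]
  have h₁ := Pseudofunctor.mapComp_id_right_inv_app L h.op.toLoc x
  have h₃ : glue L (𝟙 X) h h e x = (L.mapId ⟨op X⟩).hom.toNatTrans.app ((pull L h).obj x) := by
    refine (congrArg (· ≫ _) (h₁.trans (congrArg (_ ≫ ·)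
      (map₂_app L (ρ_ h.op.toLoc).inv x)))).trans ?_
    refine (Category.assoc _ _ _).trans ((congrArg (_ ≫ ·) (eqToHom_trans _ _)).trans ?_)
    exact Category.comp_id _
  exact (congrArg (_ ≫ ·) h₃).trans (Cat.Hom.inv_hom_id_toNatTrans_app _ _)

/-- The two ways of inserting an identity in a reindexing agree. -/
theorem unitCell_glue_swap {X Y : D} (k : X ⟶ X) (hk : k = 𝟙 X) (h : X ⟶ Y) (l : Y ⟶ Y)
    (hl : l = 𝟙 Y) (m : X ⟶ Y) (e : k ≫ h = m) (e' : h ≫ l = m) (x : L.obj ⟨op Y⟩) :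
    unitCell L k hk ((pull L h).obj x) ≫ glue L k h m e x =
      (pull L h).map (unitCell L l hl x) ≫ glue L h l m e' x := by
  obtain rfl : m = h := by rw [← e, hk, Category.id_comp]
  rw [unitCell_glue, map_unitCell_glue]

/-- Associativity of `glue`, for arbitrary names of the composites. -/
theorem map_glue_glue {X Y Z W : D} (h : X ⟶ Y) (y : Y ⟶ Z) (z : Z ⟶ W) (yz : Y ⟶ W)
    (hyz : y ≫ z = yz) (k : X ⟶ Z) (hk : h ≫ y = k) (m : X ⟶ W) (hm : k ≫ z = m)
    (hm' : h ≫ yz = m) (x : L.obj ⟨op W⟩) :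
    (pull L h).map (glue L y z yz hyz x) ≫ glue L h yz m hm' x =
      glue L h y k hk ((pull L z).obj x) ≫ glue L k z m hm x := by
  subst hyz
  rw [glue_rfl]
  exact glue_assoc L h y z k hk m hm hm' x

variable {L}

/-- The component functor of a pseudonatural transformation. -/
abbrev fibreMap (β : L ⟶ M) (X : D) : L.obj ⟨op X⟩ ⥤ M.obj ⟨op X⟩ :=
  (β.app ⟨op X⟩).toFunctor

/-- The naturality isomorphism of a pseudonatural transformation at an object of a fibre. -/
def cell (β : L ⟶ M) {X Y : D} (h : X ⟶ Y) (x : L.obj ⟨op Y⟩) :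
    (fibreMap β X).obj ((pull L h).obj x) ⟶ (pull M h).obj ((fibreMap β Y).obj x) :=
  (β.naturality h.op.toLoc).hom.toNatTrans.app x

instance isIso_cell (β : L ⟶ M) {X Y : D} (h : X ⟶ Y) (x : L.obj ⟨op Y⟩) :
    IsIso (cell β h x) :=
  ((Cat.Hom.toNatIso (β.naturality h.op.toLoc)).app x).isIso_hom

theorem cell_naturality (β : L ⟶ M) {X Y : D} (h : X ⟶ Y) {x x' : L.obj ⟨op Y⟩} (f : x ⟶ x') :
    (fibreMap β X).map ((pull L h).map f) ≫ cell β h x' =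
      cell β h x ≫ (pull M h).map ((fibreMap β Y).map f) :=
  (β.naturality h.op.toLoc).hom.toNatTrans.naturality f

theorem cell_unitCell (β : L ⟶ M) {X : D} (k : X ⟶ X) (hk : k = 𝟙 X) (x : L.obj ⟨op X⟩) :
    (fibreMap β X).map (unitCell L k hk x) ≫ cell β k x =
      unitCell M k hk ((fibreMap β X).obj x) := by
  subst hk
  rw [unitCell_rfl, unitCell_rfl]
  refine (congrArg (_ ≫ ·) (Pseudofunctor.StrongTrans.naturality_id_hom_app β ⟨op X⟩ x)).trans ?_
  refine (Category.assoc _ _ _).symm.trans ?_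
  refine (congrArg (· ≫ _) (((fibreMap β X).map_comp _ _).symm.trans ((congrArg _
    (Cat.Hom.inv_hom_id_toNatTrans_app (L.mapId ⟨op X⟩) x)).trans ?_))).trans (Category.id_comp _)
  exact (fibreMap β X).map_id _

theorem cell_glue (β : L ⟶ M) {X Y Z : D} (h : X ⟶ Y) (y : Y ⟶ Z) (k : X ⟶ Z) (hk : h ≫ y = k)
    (x : L.obj ⟨op Z⟩) :
    (fibreMap β X).map (glue L h y k hk x) ≫ cell β k x =
      cell β h ((pull L y).obj x) ≫ (pull M h).map (cell β y x) ≫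
        glue M h y k hk ((fibreMap β Z).obj x) := by
  subst hk
  rw [glue_rfl, glue_rfl]
  refine (congrArg (_ ≫ ·) (Pseudofunctor.StrongTrans.naturality_comp_hom_app β y.op.toLoc
    h.op.toLoc x)).trans ?_
  refine (Category.assoc _ _ _).symm.trans ?_
  refine (congrArg (· ≫ _) (((fibreMap β X).map_comp _ _).symm.trans ((congrArg _
    (Cat.Hom.inv_hom_id_toNatTrans_app (L.mapComp y.op.toLoc h.op.toLoc) x)).trans ?_))).trans
      (Category.id_comp _)
  exact (fibreMap β X).map_id _

/-- A pseudonatural transformation between indexed categories from functors between the fibres and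
objectwise comparison isomorphisms. -/
def mkTrans (app : ∀ X : D, L.obj ⟨op X⟩ ⥤ M.obj ⟨op X⟩)
    (c : ∀ {X Y : D} (h : X ⟶ Y) (x : L.obj ⟨op Y⟩),
      (app X).obj ((pull L h).obj x) ≅ (pull M h).obj ((app Y).obj x))
    (nat : ∀ {X Y : D} (h : X ⟶ Y) {x x' : L.obj ⟨op Y⟩} (f : x ⟶ x'),
      (app X).map ((pull L h).map f) ≫ (c h x').hom =
        (c h x).hom ≫ (pull M h).map ((app Y).map f))
    (unit : ∀ {X : D} (x : L.obj ⟨op X⟩),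
      (app X).map (unitCell L (𝟙 X) rfl x) ≫ (c (𝟙 X) x).hom =
        unitCell M (𝟙 X) rfl ((app X).obj x))
    (comp : ∀ {X Y Z : D} (h : X ⟶ Y) (y : Y ⟶ Z) (x : L.obj ⟨op Z⟩),
      (app X).map (glue L h y (h ≫ y) rfl x) ≫ (c (h ≫ y) x).hom =
        (c h ((pull L y).obj x)).hom ≫ (pull M h).map (c y x).hom ≫
          glue M h y (h ≫ y) rfl ((app Z).obj x)) : L ⟶ M where
  app X := (app X.as.unop).toCatHom
  naturality {X Y} f := Cat.Hom.isoMk (NatIso.ofComponents (fun x => c f.as.unop x)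
    (fun g => nat f.as.unop g))
  naturality_naturality {X Y f g} θ := by
    obtain rfl := LocallyDiscrete.eq_of_hom θ
    obtain rfl : θ = 𝟙 f := Subsingleton.elim _ _
    exact Cat.Hom₂.ext (NatTrans.ext (funext fun x => map_comp_eq_of_eq_id (app Y.as.unop)
      (c f.as.unop x).hom (congrArg (fun t => t.toNatTrans.app x) (L.map₂_id f))
      (congrArg (fun t => t.toNatTrans.app ((app X.as.unop).obj x)) (M.map₂_id f))))
  naturality_id X := by
    refine Cat.Hom₂.ext (NatTrans.ext (funext fun x => ?_))
    have h := unit (X := X.as.unop) x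
    rw [unitCell_rfl, unitCell_rfl] at h
    exact transpose_unit (app X.as.unop) ((Cat.Hom.toNatIso (L.mapId X)).app x) _
      ((Cat.Hom.toNatIso (M.mapId X)).app ((app X.as.unop).obj x)) h
  naturality_comp {X Y Z} f g := by
    refine Cat.Hom₂.ext (NatTrans.ext (funext fun x => ?_))
    have h := comp g.as.unop f.as.unop x
    rw [glue_rfl, glue_rfl] at h
    exact transpose_comp (app Z.as.unop) ((Cat.Hom.toNatIso (L.mapComp f g)).app x) _
      ((Cat.Hom.toNatIso (M.mapComp f g)).app ((app X.as.unop).obj x)) _ _ h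

/-- A modification from natural transformations between the component functors. -/
def mkModification {β γ : L ⟶ M} (t : ∀ X : D, fibreMap β X ⟶ fibreMap γ X)
    (h : ∀ {X Y : D} (h : X ⟶ Y) (x : L.obj ⟨op Y⟩),
      (t X).app ((pull L h).obj x) ≫ cell γ h x = cell β h x ≫ (pull M h).map ((t Y).app x)) :
    β ⟶ γ :=
  ⟨{ app := fun X => ⟨t X.as.unop⟩
     naturality := fun f => Cat.Hom₂.ext (NatTrans.ext (funext fun x => h f.as.unop x)) }⟩

/-- The component of a modification at an object. -/
abbrev modApp {β γ : L ⟶ M} (m : β ⟶ γ) (X : D) : fibreMap β X ⟶ fibreMap γ X :=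
  (m.as.app ⟨op X⟩).toNatTrans

theorem modApp_cell {β γ : L ⟶ M} (m : β ⟶ γ) {X Y : D} (h : X ⟶ Y) (x : L.obj ⟨op Y⟩) :
    (modApp m X).app ((pull L h).obj x) ≫ cell γ h x =
      cell β h x ≫ (pull M h).map ((modApp m Y).app x) :=
  congrArg (fun t => t.toNatTrans.app x) (m.as.naturality h.op.toLoc)

theorem modification_ext {β γ : L ⟶ M} {m n : β ⟶ γ}
    (h : ∀ (X : D) (x : L.obj ⟨op X⟩), (modApp m X).app x = (modApp n X).app x) : m = n :=
  Pseudofunctor.StrongTrans.homCategory.ext fun b =>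
    Cat.Hom₂.ext (NatTrans.ext (funext fun x => h b.as.unop x))

/-- An invertible modification from natural isomorphisms between the component functors. -/
def mkModIso {β γ : L ⟶ M} (t : ∀ X : D, fibreMap β X ≅ fibreMap γ X)
    (h : ∀ {X Y : D} (h : X ⟶ Y) (x : L.obj ⟨op Y⟩),
      (t X).hom.app ((pull L h).obj x) ≫ cell γ h x =
        cell β h x ≫ (pull M h).map ((t Y).hom.app x)) : β ≅ γ where
  hom := mkModification (fun X => (t X).hom) h
  inv := mkModification (fun X => (t X).inv) (fun {X Y} k x => by
    exact transpose_square (pull M k) ((t X).app ((pull L k).obj x)) ((t Y).app x) (h k x))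
  hom_inv_id := modification_ext fun X x => (t X).hom_inv_id_app x
  inv_hom_id := modification_ext fun X x => (t X).inv_hom_id_app x

theorem cell_comp (β : L ⟶ M) (γ : M ⟶ N) {X Y : D} (h : X ⟶ Y) (x : L.obj ⟨op Y⟩) :
    cell (β ≫ γ) h x = (fibreMap γ X).map (cell β h x) ≫ cell γ h ((fibreMap β Y).obj x) := by
  change 𝟙 _ ≫ (fibreMap γ X).map (cell β h x) ≫ 𝟙 _ ≫
    cell γ h ((fibreMap β Y).obj x) ≫ 𝟙 _ = _
  refine (Category.id_comp _).trans (congrArg (_ ≫ ·) ((Category.id_comp _).trans ?_))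
  exact Category.comp_id _

variable (F : C ⥤ D)

theorem glue_restrict {X Y Z : C} (h : X ⟶ Y) (y : Y ⟶ Z) (k : X ⟶ Z) (hk : h ≫ y = k)
    (x : L.obj ⟨op (F.obj Z)⟩) :
    glue (restrict F L) h y k hk x = glue L (F.map h) (F.map y) (F.map k)
      (by rw [← hk, F.map_comp]) x := by
  subst hk
  exact (glue_rfl (restrict F L) h y x).trans (congrArg (fun t => _ ≫ t)
    (map₂_app L (F.op.toPseudofunctor.mapComp y.op.toLoc h.op.toLoc).inv x))

theorem unitCell_restrict {X : C} (k : X ⟶ X) (hk : k = 𝟙 X) (x : L.obj ⟨op (F.obj X)⟩) :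
    unitCell (restrict F L) k hk x = unitCell L (F.map k) (by rw [hk, F.map_id]) x := by
  subst hk
  exact (unitCell_rfl (restrict F L) x).trans
    (congrArg (fun t => _ ≫ t) (map₂_app L (F.op.toPseudofunctor.mapId ⟨op X⟩).inv x))

end Elementwise

/-! ### Fibrewise localization of comma categories -/

section

open Localization.Construction

section Transport

variable {A : Type u₁} [Category.{v₁} A]

theorem comp_three_eq_eqToHom {a b c : A} {f : a ⟶ b} {g : b ⟶ c} {h₁ : a = b} {h₂ : b = c}
    (hf : f = eqToHom h₁) (hg : g = eqToHom h₂) :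
    f ≫ g ≫ 𝟙 c = eqToHom (h₁.trans h₂) := by
  subst h₁ h₂ hf hg
  simp

theorem comp_five_eq_eqToHom {a b c d e : A} {f : a ⟶ b} {g : b ⟶ c} {h : c ⟶ d} {k : d ⟶ e}
    {h₁ : a = b} {h₂ : b = c} {h₃ : c = d} {h₄ : d = e} (hf : f = eqToHom h₁)
    (hg : g = eqToHom h₂) (hh : h = eqToHom h₃) (hk : k = eqToHom h₄) :
    f ≫ g ≫ 𝟙 c ≫ h ≫ k = eqToHom (((h₁.trans h₂).trans h₃).trans h₄) := by
  subst h₁ h₂ h₃ h₄ hf hg hh hk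
  simp

end Transport

section LocalizedFibres

variable {P : Type u₁} [Category.{v₁} P]

/-- A natural transformation between functors out of the localization, given on the objects of the
original category. Every object `X` of the localization is definitionally `W.Q.obj X.as.obj`, so the
component at `W.Q.obj X` is definitionally `t X`. -/
def locTrans {W : MorphismProperty P} {A : Type u₃} [Category.{v₃} A] {G G' : W.Localization ⥤ A}
    (t : ∀ X : P, G.obj (W.Q.obj X) ⟶ G'.obj (W.Q.obj X))
    (h : ∀ {X Y : P} (f : X ⟶ Y),
      G.map (W.Q.map f) ≫ t Y = t X ≫ G'.map (W.Q.map f)) : G ⟶ G' where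
  app X := t X.as.obj
  naturality {X Y} f := by
    have := (natTransExtension (W := W) (F₁ := G) (F₂ := G')
      ⟨fun X => t X, fun _ _ f => h f⟩).naturality f
    have e : ∀ X : P, NatTransExtension.app (W := W) (F₁ := G) (F₂ := G')
      ⟨fun X => t X, fun _ _ f => h f⟩ (W.Q.obj X) = t X := fun X => NatTransExtension.app_eq _ X
    exact ((congrArg (_ ≫ ·) (e Y.as.obj)).symm.trans this).trans
      (congrArg (· ≫ _) (e X.as.obj))

/-- A natural isomorphism between functors out of the localization, given on the objects of the
original category. -/
def locIso {W : MorphismProperty P} {A : Type u₃} [Category.{v₃} A] {G G' : W.Localization ⥤ A}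
    (t : ∀ X : P, G.obj (W.Q.obj X) ≅ G'.obj (W.Q.obj X))
    (h : ∀ {X Y : P} (f : X ⟶ Y),
      G.map (W.Q.map f) ≫ (t Y).hom = (t X).hom ≫ G'.map (W.Q.map f)) : G ≅ G' :=
  NatIso.ofComponents (fun X => t X.as.obj)
    (fun f => (locTrans (fun X => (t X).hom) h).naturality f)

theorem lift_map_Q {W : MorphismProperty P} {A : Type u₃} [Category.{v₃} A] (G : P ⥤ A)
    (hG : W.IsInvertedBy G) {X Y : P} (f : X ⟶ Y) :
    (Localization.Construction.lift G hG).map (W.Q.map f) = G.map f := by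
  have := Functor.congr_hom (fac G hG) f
  exact this.trans ((Category.id_comp _).trans (Category.comp_id _))

variable {D : Type u₂} [Category.{v₂} D] (H : P ⥤ D) (W : MorphismProperty P)

/-- The class of the arrows of `(d ↓ H)` whose component in `P` lies in `W`. -/
def fibreW (d : D) : MorphismProperty (StructuredArrow d H) := fun _ _ f => W f.right

/-- The functor between localized comma categories induced by precomposition with `h : d ⟶ d'`. -/
def locMap {d d' : D} (h : d ⟶ d') : (fibreW H W d').Localization ⥤ (fibreW H W d).Localization :=
  Localization.Construction.lift (StructuredArrow.map h ⋙ (fibreW H W d).Q)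
    (fun _ _ f hf => (fibreW H W d).Q_inverts ((StructuredArrow.map h).map f) hf)

theorem locMap_map_Q {d d' : D} (h : d ⟶ d') {X Y : StructuredArrow d' H} (f : X ⟶ Y) :
    (locMap H W h).map ((fibreW H W d').Q.map f) =
      (fibreW H W d).Q.map ((StructuredArrow.map h).map f) :=
  lift_map_Q _ _ f

/-- The isomorphism in the localization between two arrows `d ⟶ H U` that are equal. It is
represented by the identity of `U` instead of an `eqToHom`, so that it composes with the arrows
represented by arrows of `P`. -/
def reIso {d : D} {U : P} (f g : d ⟶ H.obj U) (h : f = g) :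
    (fibreW H W d).Q.obj (StructuredArrow.mk f) ≅ (fibreW H W d).Q.obj (StructuredArrow.mk g) :=
  (fibreW H W d).Q.mapIso (StructuredArrow.isoMk (Iso.refl U) (by simp [h]))

theorem reIso_hom {d : D} {U : P} (f g : d ⟶ H.obj U) (h : f = g) :
    (reIso H W f g h).hom = (fibreW H W d).Q.map (StructuredArrow.homMk (𝟙 U) (by simp [h])) :=
  rfl

theorem reIso_hom_eq {d : D} {U : P} (f g : d ⟶ H.obj U) (h : f = g) :
    (reIso H W f g h).hom = eqToHom (by rw [h]) := by
  subst h
  exact (fibreW H W d).Q.map_id _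

theorem reIso_inv_eq {d : D} {U : P} (f g : d ⟶ H.obj U) (h : f = g) :
    (reIso H W f g h).inv = eqToHom (by rw [h]) := by
  subst h
  exact (fibreW H W d).Q.map_id _

theorem locMap_reIso {d d' : D} (e : d ⟶ d') {U : P} (f g : d' ⟶ H.obj U) (h : f = g) :
    (locMap H W e).map (reIso H W f g h).hom = (reIso H W (e ≫ f) (e ≫ g) (by rw [h])).hom := by
  rw [reIso_hom]
  refine (locMap_map_Q H W e _).trans (congrArg _ ?_)
  ext
  rfl

/-- Reindexing along an identity is isomorphic to the identity functor. -/
def locMapId (d : D) : locMap H W (𝟙 d) ≅ 𝟭 _ :=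
  locIso (fun X => reIso H W (𝟙 d ≫ X.hom) X.hom (Category.id_comp _)) (fun {X Y} f => by
    rw [locMap_map_Q]
    refine (Functor.map_comp _ _ _).symm.trans (Eq.trans (congrArg _ ?_) (Functor.map_comp _ _ _))
    ext
    exact (Category.comp_id _).trans (Category.id_comp _).symm)

/-- Reindexing along a composite is isomorphic to the composite of the reindexings. -/
def locMapComp {a b c : D} (h : a ⟶ b) (y : b ⟶ c) :
    locMap H W (h ≫ y) ≅ locMap H W y ⋙ locMap H W h :=
  locIso (fun X => reIso H W ((h ≫ y) ≫ X.hom) (h ≫ y ≫ X.hom) (Category.assoc _ _ _))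
    (fun {X Y} f => by
      rw [locMap_map_Q]
      have e : (locMap H W y ⋙ locMap H W h).map ((fibreW H W c).Q.map f) =
        (fibreW H W a).Q.map ((StructuredArrow.map h).map ((StructuredArrow.map y).map f)) :=
        (congrArg _ (locMap_map_Q H W y f)).trans (locMap_map_Q H W h _)
      rw [e]
      refine (Functor.map_comp _ _ _).symm.trans
        (Eq.trans (congrArg _ ?_) (Functor.map_comp _ _ _))
      ext
      exact (Category.comp_id _).trans (Category.id_comp _).symm)

/-- The `D`-indexed category whose fibre over `d` is the localization of `(d ↓ H)` at the arrows
with component in `W`, with reindexing by precomposition. -/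
def locIndexed : LocallyDiscrete Dᵒᵖ ⥤ᵖ
    Cat.{max u₁ v₁ v₂, max u₁ v₂} :=
  LocallyDiscrete.mkPseudofunctor
    (fun d => Cat.of (fibreW H W d.unop).Localization)
    (fun h => (locMap H W h.unop).toCatHom)
    (fun d => Cat.Hom.isoMk (locMapId H W d.unop))
    (fun y h => Cat.Hom.isoMk (locMapComp H W h.unop y.unop))
    (fun f g h => Cat.Hom₂.ext (NatTrans.ext (funext fun X =>
      (comp_five_eq_eqToHom (reIso_hom_eq H W _ _ (Category.assoc _ _ _))
        ((locMap_reIso H W h.unop _ _ (Category.assoc _ _ _)).trans (reIso_hom_eq H W _ _ _))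
        (reIso_inv_eq H W _ _ (Category.assoc _ _ _))
        (reIso_inv_eq H W _ _ (Category.assoc _ _ _))).trans
          (Cat.eqToHom_app (locMap H W ((f ≫ g) ≫ h).unop).toCatHom
            (locMap H W (f ≫ g ≫ h).unop).toCatHom (by rw [Category.assoc]) X).symm)))
    (fun f => Cat.Hom₂.ext (NatTrans.ext (funext fun X =>
      (comp_three_eq_eqToHom (reIso_hom_eq H W _ _ (Category.assoc _ _ _))
        ((locMap_reIso H W f.unop _ _ (Category.id_comp _)).trans
          (reIso_hom_eq H W _ _ _))).trans (Cat.eqToHom_app (locMap H W (𝟙 _ ≫ f).unop).toCatHom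
            (locMap H W f.unop).toCatHom (by rw [Category.id_comp]) X).symm)))
    (fun f => Cat.Hom₂.ext (NatTrans.ext (funext fun X =>
      (comp_three_eq_eqToHom (reIso_hom_eq H W _ _ (Category.assoc _ _ _))
        (reIso_hom_eq H W (𝟙 _ ≫ f.unop ≫ X.as.obj.hom) (f.unop ≫ X.as.obj.hom)
          (Category.id_comp _))).trans (Cat.eqToHom_app (locMap H W (f ≫ 𝟙 _).unop).toCatHom
            (locMap H W f.unop).toCatHom (by rw [Category.comp_id]) X).symm)))

/-- The object of the fibre of `locIndexed` over `d` represented by an arrow `f : d ⟶ H U`. -/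
def locObj {d : D} {U : P} (f : d ⟶ H.obj U) : (locIndexed H W).obj ⟨op d⟩ :=
  (fibreW H W d).Q.obj (StructuredArrow.mk f)

/-- The arrow of the fibre of `locIndexed` over `d` represented by an arrow of `(d ↓ H)`. -/
def locHom {d : D} {U V : P} (f : d ⟶ H.obj U) (g : d ⟶ H.obj V) (a : U ⟶ V)
    (h : f ≫ H.map a = g) : locObj H W f ⟶ locObj H W g :=
  (fibreW H W d).Q.map (StructuredArrow.homMk (f := StructuredArrow.mk f)
    (f' := StructuredArrow.mk g) a h)

theorem locHom_id {d : D} {U : P} (f : d ⟶ H.obj U) (h : f ≫ H.map (𝟙 U) = f) :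
    locHom H W f f (𝟙 U) h = 𝟙 _ :=
  (fibreW H W d).Q.map_id _

theorem locHom_comp {d : D} {U V Z : P} (f : d ⟶ H.obj U) (g : d ⟶ H.obj V) (k : d ⟶ H.obj Z)
    (a : U ⟶ V) (b : V ⟶ Z) (h : f ≫ H.map a = g) (h' : g ≫ H.map b = k) :
    locHom H W f g a h ≫ locHom H W g k b h' =
      locHom H W f k (a ≫ b) (by rw [H.map_comp, ← Category.assoc, h, h']) :=
  ((fibreW H W d).Q.map_comp _ _).symm

theorem map_locHom {d d' : D} (e : d ⟶ d') {U V : P} (f : d' ⟶ H.obj U) (g : d' ⟶ H.obj V)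
    (a : U ⟶ V) (h : f ≫ H.map a = g) :
    ((locIndexed H W).map e.op.toLoc).toFunctor.map (locHom H W f g a h) =
      locHom H W (e ≫ f) (e ≫ g) a (by rw [Category.assoc, h]) :=
  locMap_map_Q H W e _

theorem isIso_locHom {d : D} {U V : P} (f : d ⟶ H.obj U) (g : d ⟶ H.obj V) (a : U ⟶ V)
    (h : f ≫ H.map a = g) (ha : W a) : IsIso (locHom H W f g a h) :=
  (fibreW H W d).Q_inverts _ ha

theorem mapComp_inv_app_locObj {a b c : D} (h : a ⟶ b) (y : b ⟶ c) {U : P} (f : c ⟶ H.obj U) :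
    ((locIndexed H W).mapComp y.op.toLoc h.op.toLoc).inv.toNatTrans.app (locObj H W f) =
      locHom H W (h ≫ y ≫ f) ((h ≫ y) ≫ f) (𝟙 U) (by simp) :=
  rfl

theorem mapId_inv_app_locObj {d : D} {U : P} (f : d ⟶ H.obj U) :
    ((locIndexed H W).mapId ⟨op d⟩).inv.toNatTrans.app (locObj H W f) =
      locHom H W f (𝟙 d ≫ f) (𝟙 U) (by simp) :=
  rfl

end LocalizedFibres

end

/-! ### Cartesian arrows of Grothendieck constructions -/

section TotalCategory

open Pseudofunctor Pseudofunctor.CoGrothendieck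

variable {C : Type u₁} [Category.{v₁} C] {E : LocallyDiscrete Cᵒᵖ ⥤ᵖ Cat.{v₂, u₂}}

/-- The arrow of the Grothendieck construction over an identity given by an arrow of a fibre. -/
def vert (X : C) {U V : E.obj ⟨op X⟩} (u : U ⟶ V) : (⟨X, U⟩ : ∫ᶜ E) ⟶ ⟨X, V⟩ :=
  ⟨𝟙 X, u ≫ (E.mapId ⟨op X⟩).inv.toNatTrans.app V⟩

/-- The cartesian arrow with codomain `(X, U)` over `y : Y ⟶ X`. -/
def cartArrow {X Y : C} (y : Y ⟶ X) (U : E.obj ⟨op X⟩) :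
    (⟨Y, (E.map y.op.toLoc).toFunctor.obj U⟩ : ∫ᶜ E) ⟶ ⟨X, U⟩ :=
  ⟨y, 𝟙 _⟩

theorem vert_comp {b : ∫ᶜ E} {X : C} {U V : E.obj ⟨op X⟩} (u : U ⟶ V)
    (f : (⟨X, V⟩ : ∫ᶜ E) ⟶ b) : vert X u ≫ f = ⟨f.base, u ≫ f.fiber⟩ := by
  refine Hom.ext _ _ (Category.id_comp _) ?_
  refine (Category.assoc _ _ _).trans ?_
  refine (congrArg (u ≫ ·) (Hom.congr (Category.id_comp f))).trans (Category.assoc _ _ _).symm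

theorem comp_vert {a : ∫ᶜ E} {X : C} {U V : E.obj ⟨op X⟩} (u : U ⟶ V)
    (f : a ⟶ (⟨X, U⟩ : ∫ᶜ E)) :
    f ≫ vert X u = ⟨f.base, f.fiber ≫ (E.map f.base.op.toLoc).toFunctor.map u⟩ := by
  let g : a ⟶ (⟨X, V⟩ : ∫ᶜ E) := ⟨f.base, f.fiber ≫ (E.map f.base.op.toLoc).toFunctor.map u⟩
  refine Hom.ext _ _ (Category.comp_id _) ?_
  refine Eq.trans ?_ (Hom.congr (Category.comp_id g))
  refine (congrArg (f.fiber ≫ ·) (congrArg (· ≫ _) (Functor.map_comp _ _ _))).trans ?_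
  refine (congrArg (f.fiber ≫ ·) (Category.assoc _ _ _)).trans (Category.assoc _ _ _).symm

theorem vert_id {X : C} (U : E.obj ⟨op X⟩) : vert X (𝟙 U) = 𝟙 (⟨X, U⟩ : ∫ᶜ E) :=
  congrArg (fun t => (⟨𝟙 X, t⟩ : (⟨X, U⟩ : ∫ᶜ E) ⟶ ⟨X, U⟩)) (Category.id_comp _)

theorem vert_comp_vert {X : C} {U V Z : E.obj ⟨op X⟩} (u : U ⟶ V) (v : V ⟶ Z) :
    (vert X u : (⟨X, U⟩ : ∫ᶜ E) ⟶ _) ≫ vert X v = vert X (u ≫ v) :=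
  (vert_comp u (vert X v)).trans
    (congrArg (fun t => (⟨𝟙 X, t⟩ : (⟨X, U⟩ : ∫ᶜ E) ⟶ ⟨X, Z⟩)) (Category.assoc _ _ _).symm)

theorem vert_comp_cartArrow {a b : ∫ᶜ E} (f : a ⟶ b) :
    vert a.base f.fiber ≫ cartArrow f.base b.fiber = f :=
  (vert_comp f.fiber (cartArrow f.base b.fiber)).trans
    (congrArg (fun t => (⟨f.base, t⟩ : a ⟶ b)) (Category.comp_id _))

theorem eq_vert {X : C} {U V : E.obj ⟨op X⟩} (f : (⟨X, U⟩ : ∫ᶜ E) ⟶ ⟨X, V⟩)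
    (hf : f.base = 𝟙 X) : ∃ u : U ⟶ V, f = vert X u := by
  obtain ⟨y, u⟩ := f
  obtain rfl : y = 𝟙 X := hf
  refine ⟨u ≫ (E.mapId ⟨op X⟩).hom.toNatTrans.app V, ?_⟩
  refine congrArg (fun t => (⟨𝟙 X, t⟩ : (⟨X, U⟩ : ∫ᶜ E) ⟶ ⟨X, V⟩)) ?_
  refine ((congrArg (u ≫ ·) (Cat.Hom.hom_inv_id_toNatTrans_app (E.mapId ⟨op X⟩) V)).trans
    (Category.comp_id u)).symm.trans (Category.assoc _ _ _).symm

theorem fiber_injective {a b : ∫ᶜ E} {y : a.base ⟶ b.base}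
    {u v : a.fiber ⟶ (E.map y.op.toLoc).toFunctor.obj b.fiber}
    (h : (⟨y, u⟩ : a ⟶ b) = ⟨y, v⟩) : u = v :=
  (Hom.congr h).trans (Category.comp_id _)

theorem vert_injective {X : C} {U V : E.obj ⟨op X⟩} {u v : U ⟶ V}
    (h : (vert X u : (⟨X, U⟩ : ∫ᶜ E) ⟶ _) = vert X v) : u = v := by
  have := fiber_injective h
  exact (cancel_mono ((Cat.Hom.toNatIso (E.mapId ⟨op X⟩)).inv.app V)).1 this

theorem isCart_cartArrow {X Y : C} (y : Y ⟶ X) (U : E.obj ⟨op X⟩) :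
    IsCart (forget E) (cartArrow y U) :=
  isStronglyCartesian_homCartesianLift U y

instance isIso_vert {X : C} {U V : E.obj ⟨op X⟩} (u : U ⟶ V) [IsIso u] :
    IsIso (vert X u : (⟨X, U⟩ : ∫ᶜ E) ⟶ _) :=
  ⟨vert X (inv u), by rw [vert_comp_vert, IsIso.hom_inv_id, vert_id],
    by rw [vert_comp_vert, IsIso.inv_hom_id, vert_id]⟩

end TotalCategory

section Cartesian

variable {C : Type u₁} [Category.{v₁} C] {P : Type u₃} [Category.{v₃} P]

theorem IsCart.comp {p : P ⥤ C} {a b c : P} {f : a ⟶ b} {g : b ⟶ c} (hf : IsCart p f)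
    (hg : IsCart p g) : IsCart p (f ≫ g) := by
  rw [isCart_iff] at hf hg ⊢
  intro z h k hk
  obtain ⟨l, ⟨hl, hl'⟩, hlu⟩ := hg z h (k ≫ p.map f) (by rw [hk, p.map_comp, Category.assoc])
  obtain ⟨m, ⟨hm, hm'⟩, hmu⟩ := hf z l k hl
  refine ⟨m, ⟨hm, by rw [← Category.assoc, hm', hl']⟩, ?_⟩
  rintro m' ⟨h₁, h₂⟩
  exact hmu m' ⟨h₁, hlu _ ⟨by rw [p.map_comp, h₁], by rw [Category.assoc, h₂]⟩⟩

theorem isCart_of_isIso (p : P ⥤ C) {a b : P} (f : a ⟶ b) [IsIso f] : IsCart p f := by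
  rw [isCart_iff]
  intro z h k hk
  refine ⟨h ≫ inv f, ⟨by rw [p.map_comp, hk, Category.assoc, ← p.map_comp, IsIso.hom_inv_id,
    p.map_id, Category.comp_id], by simp⟩, ?_⟩
  rintro m ⟨-, h₂⟩
  rw [← h₂, Category.assoc, IsIso.hom_inv_id, Category.comp_id]

/-- A cartesian arrow over an invertible arrow is invertible. -/
theorem IsCart.isIso {p : P ⥤ C} {a b : P} {f : a ⟶ b} (hf : IsCart p f) [IsIso (p.map f)] :
    IsIso f := by
  rw [isCart_iff] at hf
  obtain ⟨k, ⟨hk, hk'⟩, -⟩ := hf b (𝟙 b) (inv (p.map f)) (by simp)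
  refine ⟨k, (hf a f (𝟙 _) (by simp)).unique ⟨?_, ?_⟩ ⟨p.map_id _, Category.id_comp _⟩, hk'⟩
  · rw [p.map_comp, hk, IsIso.hom_inv_id]
  · rw [Category.assoc, hk', Category.comp_id]

theorem IsCart.of_comp {p : P ⥤ C} {a b c : P} {f : a ⟶ b} {g : b ⟶ c} (hg : IsCart p g)
    (h : IsCart p (f ≫ g)) : IsCart p f := by
  rw [isCart_iff] at h hg ⊢
  intro z k l hl
  obtain ⟨m, ⟨hm, hm'⟩, hmu⟩ := h z (k ≫ g) l (by rw [p.map_comp, hl, p.map_comp, Category.assoc])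
  refine ⟨m, ⟨hm, ?_⟩, ?_⟩
  · exact (hg z (k ≫ g) (l ≫ p.map f) (by rw [p.map_comp, hl])).unique
      ⟨by rw [p.map_comp, hm], by rw [Category.assoc, hm']⟩ ⟨hl, rfl⟩
  · rintro m' ⟨h₁, h₂⟩
    exact hmu m' ⟨h₁, by rw [← h₂, Category.assoc]⟩

open Pseudofunctor Pseudofunctor.CoGrothendieck in
/-- The cartesian arrows of a Grothendieck construction are those with invertible fibre
component. -/
theorem isCart_forget_iff {E : LocallyDiscrete Cᵒᵖ ⥤ᵖ Cat.{v₂, u₂}} {a b : ∫ᶜ E} (f : a ⟶ b) :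
    IsCart (forget E) f ↔ IsIso f.fiber := by
  constructor
  · intro hf
    have hc : IsCart (forget E) (vert a.base f.fiber ≫ cartArrow f.base b.fiber) := by
      rwa [vert_comp_cartArrow]
    have hv : IsCart (forget E) (vert a.base f.fiber) :=
      IsCart.of_comp (isCart_cartArrow f.base b.fiber) hc
    have : IsIso ((forget E).map (vert a.base f.fiber)) :=
      inferInstanceAs (IsIso (𝟙 a.base))
    have hi : IsIso (vert a.base f.fiber) := hv.isIso
    obtain ⟨g, hg, hg'⟩ := hi
    have hb : g.base = 𝟙 a.base :=
      (Category.id_comp g.base).symm.trans (congrArg (fun t => t.base) hg)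
    obtain ⟨u, rfl⟩ := eq_vert g hb
    rw [vert_comp_vert, ← vert_id] at hg hg'
    exact ⟨u, vert_injective hg, vert_injective hg'⟩
  · intro hf
    rw [← vert_comp_cartArrow f]
    exact (isCart_of_isIso _ _).comp (isCart_cartArrow _ _)

end Cartesian

/-! ### The fibrewise localization as an inverse image, and its unit -/

section

open Pseudofunctor Pseudofunctor.CoGrothendieck

section

variable {C : Type u₁} [Category.{v₁} C] (E : LocallyDiscrete Cᵒᵖ ⥤ᵖ Cat.{v₂, u₂})

/-- The cartesian arrows of the Grothendieck construction of `E`. -/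
def totalCart : MorphismProperty (∫ᶜ E) := fun _ _ f => IsCart (forget E) f

end

section

variable {C : Type u₁} [Category.{v₁} C] {E : LocallyDiscrete Cᵒᵖ ⥤ᵖ Cat.{w, w}}

theorem vert_unitCell_comp_cartArrow {X : C} (U : E.obj ⟨op X⟩) :
    vert X (unitCell E (𝟙 X) rfl U) ≫ cartArrow (𝟙 X) U = 𝟙 (⟨X, U⟩ : ∫ᶜ E) := by
  refine (vert_comp _ _).trans ?_
  exact congrArg (fun t => (⟨𝟙 X, t⟩ : (⟨X, U⟩ : ∫ᶜ E) ⟶ ⟨X, U⟩))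
    ((Category.comp_id _).trans (unitCell_rfl E U))

theorem vert_glue_comp_cartArrow {X Y Z : C} (h : X ⟶ Y) (y : Y ⟶ Z) (U : E.obj ⟨op Z⟩) :
    vert X (glue E h y (h ≫ y) rfl U) ≫ cartArrow (h ≫ y) U =
      cartArrow h ((pull E y).obj U) ≫ cartArrow y U := by
  refine (vert_comp _ _).trans ?_
  refine congrArg (fun t => (⟨h ≫ y, t⟩ :
    (⟨X, (pull E h).obj ((pull E y).obj U)⟩ : ∫ᶜ E) ⟶ ⟨Z, U⟩)) ?_
  refine (Category.comp_id _).trans ((glue_rfl E h y U).trans ?_)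
  refine Eq.symm ((Category.id_comp _).trans ((congrArg (· ≫ _)
    (CategoryTheory.Functor.map_id _ _)).trans ?_))
  exact Category.id_comp _

theorem vert_map_comp_cartArrow {X Y : C} (h : X ⟶ Y) {U V : E.obj ⟨op Y⟩} (u : U ⟶ V) :
    vert X ((pull E h).map u) ≫ cartArrow h V = cartArrow h U ≫ vert Y u := by
  refine (vert_comp _ _).trans (Eq.trans ?_ (comp_vert _ _).symm)
  exact congrArg (fun t => (⟨h, t⟩ : (⟨X, (pull E h).obj U⟩ : ∫ᶜ E) ⟶ ⟨Y, V⟩))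
    ((Category.comp_id _).trans (Category.id_comp _).symm)

end

section IndexedUnit

variable {C : Type u₁} [Category.{v₁} C] {D : Type u₂} [Category.{v₂} D] (F : C ⥤ D)
  (E : LocallyDiscrete Cᵒᵖ ⥤ᵖ Cat.{max w u₁ v₁ v₂, max w u₁ v₁ v₂})

/-- The inverse image of `E`: its fibre over `d` is the localization of `(d ↓ F ∘ p_E)` at the
arrows with cartesian component. The universe bound makes these localizations small when `C` and
the hom-sets of `D` are. -/
def lan : LocallyDiscrete Dᵒᵖ ⥤ᵖ Cat.{max w u₁ v₁ v₂, max w u₁ v₁ v₂} :=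
  locIndexed (forget E ⋙ F) (totalCart E)

variable {E}

/-- The object of the fibre of `lan` over `d` represented by `x : d ⟶ F X` and `U` in `E(X)`. -/
def lanObj {d : D} (U : ∫ᶜ E) (x : d ⟶ F.obj U.base) : (lan F E).obj ⟨op d⟩ :=
  locObj (forget E ⋙ F) (totalCart E) (U := U) x

/-- The arrow of the fibre of `lan` over `d` represented by an arrow of `(d ↓ F ∘ p_E)`. -/
def lanHom {d : D} {U V : ∫ᶜ E} (x : d ⟶ F.obj U.base) (x' : d ⟶ F.obj V.base) (f : U ⟶ V)
    (h : x ≫ F.map f.base = x') : lanObj F U x ⟶ lanObj F V x' :=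
  locHom (forget E ⋙ F) (totalCart E) x x' f h

theorem comp_map_id_base {d : D} {U : ∫ᶜ E} (x : d ⟶ F.obj U.base) :
    x ≫ F.map (𝟙 U : U ⟶ U).base = x :=
  (congrArg (x ≫ ·) (F.map_id U.base)).trans (Category.comp_id x)

theorem lanHom_id {d : D} {U : ∫ᶜ E} (x : d ⟶ F.obj U.base) (f : U ⟶ U) (hf : f = 𝟙 U)
    (h : x ≫ F.map f.base = x) : lanHom F x x f h = 𝟙 _ := by
  subst hf
  exact locHom_id (forget E ⋙ F) (totalCart E) x h

theorem lanHom_comp {d : D} {U V Z : ∫ᶜ E} (x : d ⟶ F.obj U.base) (x' : d ⟶ F.obj V.base)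
    (x'' : d ⟶ F.obj Z.base) (f : U ⟶ V) (g : V ⟶ Z) (h : x ≫ F.map f.base = x')
    (h' : x' ≫ F.map g.base = x'') (k : U ⟶ Z) (hk : f ≫ g = k) :
    lanHom F x x' f h ≫ lanHom F x' x'' g h' = lanHom F x x'' k (by
      rw [← hk, ← h', ← h, Category.assoc, ← F.map_comp]
      rfl) := by
  subst hk
  exact locHom_comp (forget E ⋙ F) (totalCart E) x x' x'' f g h h'

theorem pull_lanHom {d d' : D} (e : d ⟶ d') {U V : ∫ᶜ E} (x : d' ⟶ F.obj U.base)
    (x' : d' ⟶ F.obj V.base) (f : U ⟶ V) (h : x ≫ F.map f.base = x') :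
    (pull (lan F E) e).map (lanHom F x x' f h) =
      lanHom F (e ≫ x) (e ≫ x') f (by rw [Category.assoc, h]) :=
  map_locHom (forget E ⋙ F) (totalCart E) e x x' f h

theorem isIso_lanHom {d : D} {U V : ∫ᶜ E} (x : d ⟶ F.obj U.base) (x' : d ⟶ F.obj V.base)
    (f : U ⟶ V) (h : x ≫ F.map f.base = x') (hf : IsCart (forget E) f) :
    IsIso (lanHom F x x' f h) :=
  isIso_locHom (forget E ⋙ F) (totalCart E) x x' f h hf

theorem glue_lan {a b c : D} (h : a ⟶ b) (y : b ⟶ c) (k : a ⟶ c) (hk : h ≫ y = k) {U : ∫ᶜ E}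
    (x : c ⟶ F.obj U.base) :
    glue (lan F E) h y k hk (lanObj F U x) = lanHom F (h ≫ y ≫ x) (k ≫ x) (𝟙 U) (by
      rw [comp_map_id_base, ← hk, Category.assoc]) := by
  subst hk
  exact (glue_rfl (lan F E) h y _).trans
    (mapComp_inv_app_locObj (forget E ⋙ F) (totalCart E) h y x)

theorem unitCell_lan {d : D} (k : d ⟶ d) (hk : k = 𝟙 d) {U : ∫ᶜ E} (x : d ⟶ F.obj U.base) :
    unitCell (lan F E) k hk (lanObj F U x) = lanHom F x (k ≫ x) (𝟙 U) (by
      rw [comp_map_id_base, hk, Category.id_comp]) := by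
  subst hk
  exact (unitCell_rfl (lan F E) _).trans
    (mapId_inv_app_locObj (forget E ⋙ F) (totalCart E) x)

theorem id_comp_map_vert {X : C} {U V : E.obj ⟨op X⟩} (u : U ⟶ V) :
    𝟙 (F.obj X) ≫ F.map (vert X u : (⟨X, U⟩ : ∫ᶜ E) ⟶ ⟨X, V⟩).base = 𝟙 (F.obj X) :=
  (Category.id_comp _).trans (F.map_id X)

variable (E) in
/-- The fibre components of the unit of the inverse image: `U` in `E(X)` is sent to the object
represented by the identity of `F X`. -/
def unitApp (X : C) : E.obj ⟨op X⟩ ⥤ (lan F E).obj ⟨op (F.obj X)⟩ where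
  obj U := lanObj F ⟨X, U⟩ (𝟙 (F.obj X))
  map {U V} u := lanHom F (U := ⟨X, U⟩) (V := ⟨X, V⟩) (𝟙 _) (𝟙 _) (vert X u) (id_comp_map_vert F u)
  map_id U := lanHom_id F _ _ (vert_id U) _
  map_comp u v := (lanHom_comp F _ _ _ _ _ _ _ _ (vert_comp_vert u v)).symm

/-- The comparison isomorphism of the unit, represented by a cartesian arrow. -/
def unitComparison {X Y : C} (h : X ⟶ Y) (U : E.obj ⟨op Y⟩) :
    (unitApp F E X).obj ((pull E h).obj U) ≅
      (pull (lan F E) (F.map h)).obj ((unitApp F E Y).obj U) :=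
  @asIso _ _ _ _ (lanHom F (U := ⟨X, (pull E h).obj U⟩) (V := ⟨Y, U⟩) (𝟙 (F.obj X))
      (F.map h ≫ 𝟙 (F.obj Y)) (cartArrow h U)
      ((Category.id_comp _).trans (Category.comp_id _).symm))
    (isIso_lanHom F _ _ _ _ (isCart_cartArrow h U))

variable (E) in
/-- The unit of the inverse image. -/
def lanUnit : E ⟶ restrict F (lan F E) :=
  mkTrans (unitApp F E) (unitComparison F)
    (fun {X Y} h {U V} u =>
      (lanHom_comp F _ _ _ _ _ _ _ _ (vert_map_comp_cartArrow h u)).trans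
        ((congrArg (_ ≫ ·) (pull_lanHom F (F.map h) _ _ (vert Y u) _)).trans
          (lanHom_comp F _ _ _ _ _ _ _ _ rfl)).symm)
    (fun {X} U => (lanHom_comp F _ _ _ _ _ _ _ _ (vert_unitCell_comp_cartArrow U)).trans
      ((unitCell_restrict F (𝟙 X) rfl _).trans
        (unitCell_lan F (F.map (𝟙 X)) (F.map_id X) (U := ⟨X, U⟩) (𝟙 (F.obj X)))).symm)
    (fun {X Y Z} h y U => by
      refine (lanHom_comp F _ _ _ _ _ _ _ _ (vert_glue_comp_cartArrow h y U)).trans ?_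
      refine Eq.symm ((congrArg (_ ≫ ·) ((congrArg (_ ≫ ·) ((glue_restrict F h y _ rfl _).trans
        (glue_lan F (F.map h) (F.map y) _ (F.map_comp h y).symm (U := ⟨Z, U⟩) (𝟙 _)))).trans
          ((congrArg (· ≫ _) (pull_lanHom F (F.map h) _ _ (cartArrow y U) _)).trans
            (lanHom_comp F _ _ _ _ _ _ _ _ (Category.comp_id _))))).trans ?_)
      exact lanHom_comp F _ _ _ _ _ _ _ _ rfl)

end IndexedUnit

end

/-! ### Transposition along the unit -/

section

open Pseudofunctor Pseudofunctor.CoGrothendieck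

section

variable {A : Type u₁} [Category.{v₁} A]

theorem comp_hom_eq_of_inv_comp {a b c d e : A} (i : a ≅ b) (j : b ≅ c) (k : d ≅ e) {r : a ⟶ d}
    {g : c ⟶ e} (h : j.inv ≫ i.inv ≫ r = g ≫ k.inv) : r ≫ k.hom = i.hom ≫ j.hom ≫ g := by
  rw [← Iso.eq_comp_inv, Category.assoc, Category.assoc, ← h]
  simp

end

section Coherence

variable {D : Type u₂} [Category.{v₂} D] (M : LocallyDiscrete Dᵒᵖ ⥤ᵖ Cat.{w, w})

/-- The identity isomorphism between the reindexings along two equal arrows. -/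
def rebase {X Y : D} (x x' : X ⟶ Y) (h : x = x') (u : M.obj ⟨op Y⟩) :
    (pull M x).obj u ⟶ (pull M x').obj u :=
  eqToHom (by rw [h])

theorem glue_rebase {X Y Z : D} (h : X ⟶ Y) (y : Y ⟶ Z) (k k' : X ⟶ Z) (hk : h ≫ y = k)
    (e : k = k') (u : M.obj ⟨op Z⟩) :
    glue M h y k hk u ≫ rebase M k k' e u = glue M h y k' (hk.trans e) u := by
  subst e
  exact Category.comp_id _

theorem unitCell_glue_eq_rebase {X Y : D} (x m : X ⟶ Y) (e : 𝟙 X ≫ x = m) (u : M.obj ⟨op Y⟩) :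
    unitCell M (𝟙 X) rfl ((pull M x).obj u) ≫ glue M (𝟙 X) x m e u =
      rebase M x m ((Category.id_comp x).symm.trans e) u := by
  obtain rfl : x = m := (Category.id_comp x).symm.trans e
  exact unitCell_glue M (𝟙 X) rfl x e u

/-- The inverse of `glue`, as an isomorphism. -/
def unglue {X Y Z : D} (h : X ⟶ Y) (x : Y ⟶ Z) (u : M.obj ⟨op Z⟩) :
    (pull M (h ≫ x)).obj u ≅ (pull M h).obj ((pull M x).obj u) :=
  (asIso (glue M h x (h ≫ x) rfl u)).symm

theorem unglue_naturality {X Y Z : D} (h : X ⟶ Y) (x : Y ⟶ Z) {u v : M.obj ⟨op Z⟩} (f : u ⟶ v) :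
    (pull M (h ≫ x)).map f ≫ (unglue M h x v).hom =
      (unglue M h x u).hom ≫ (pull M h).map ((pull M x).map f) := by
  rw [← Iso.eq_comp_inv, Category.assoc, ← Iso.inv_comp_eq]
  exact (glue_naturality M h x (h ≫ x) rfl f).symm

theorem unglue_square {X Y Z T : D} (h : X ⟶ Y) (x : Y ⟶ Z) (y : Z ⟶ T) (x' : Y ⟶ T)
    (e : x ≫ y = x') (e' : (h ≫ x) ≫ y = h ≫ x') {u : M.obj ⟨op Z⟩} {v : M.obj ⟨op T⟩}
    (φ : u ⟶ (pull M y).obj v) :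
    ((pull M (h ≫ x)).map φ ≫ glue M (h ≫ x) y (h ≫ x') e' v) ≫ (unglue M h x' v).hom =
      (unglue M h x u).hom ≫ (pull M h).map ((pull M x).map φ ≫ glue M x y x' e v) := by
  rw [← Iso.eq_comp_inv, Category.assoc, ← Iso.inv_comp_eq, Functor.map_comp, Category.assoc]
  refine (Category.assoc _ _ _).symm.trans ?_
  refine (congrArg (· ≫ _) (glue_naturality M h x (h ≫ x) rfl φ).symm).trans ?_
  refine (Category.assoc _ _ _).trans (congrArg (_ ≫ ·) ?_)
  exact (map_glue_glue M h x y x' e (h ≫ x) rfl (h ≫ x') e' rfl v).symm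

theorem rebase_unglue {X Y : D} (x : X ⟶ Y) (u : M.obj ⟨op Y⟩) :
    rebase M x (𝟙 X ≫ x) (Category.id_comp x).symm u ≫ (unglue M (𝟙 X) x u).hom =
      unitCell M (𝟙 X) rfl ((pull M x).obj u) := by
  rw [← Iso.eq_comp_inv]
  exact (unitCell_glue_eq_rebase M x _ rfl u).symm

theorem rebase_unglue_comp {X Y Z T : D} (h : X ⟶ Y) (y : Y ⟶ Z) (x : Z ⟶ T)
    (u : M.obj ⟨op T⟩) :
    rebase M (h ≫ y ≫ x) ((h ≫ y) ≫ x) (Category.assoc h y x).symm u ≫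
        (unglue M (h ≫ y) x u).hom =
      (unglue M h (y ≫ x) u).hom ≫ (pull M h).map (unglue M y x u).hom ≫
        glue M h y (h ≫ y) rfl ((pull M x).obj u) := by
  refine comp_hom_eq_of_inv_comp (unglue M h (y ≫ x) u) ((pull M h).mapIso (unglue M y x u))
    (unglue M (h ≫ y) x u) ?_
  refine (congrArg (_ ≫ ·) (glue_rebase M h (y ≫ x) _ _ rfl (Category.assoc h y x).symm u)).trans ?_
  exact map_glue_glue M h y x (y ≫ x) rfl (h ≫ y) rfl _ rfl (Category.assoc h y x).symm u

end Coherence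

section Transpose

variable {C : Type u₁} [Category.{v₁} C] {D : Type u₂} [Category.{v₂} D] (F : C ⥤ D)
  {E : LocallyDiscrete Cᵒᵖ ⥤ᵖ Cat.{max w u₁ v₁ v₂, max w u₁ v₁ v₂}}
  {M : LocallyDiscrete Dᵒᵖ ⥤ᵖ Cat.{max w u₁ v₁ v₂, max w u₁ v₁ v₂}}

/-- Naturality of a family indexed by the objects of a fibre of `lan` can be checked on the arrows
represented by arrows of the comma category. -/
theorem lan_naturality {d : D} {A : Type u₃} [Category.{v₃} A]
    {G G' : (lan F E).obj ⟨op d⟩ ⥤ A} (t : ∀ z, G.obj z ⟶ G'.obj z)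
    (h : ∀ {U V : ∫ᶜ E} (x : d ⟶ F.obj U.base) (x' : d ⟶ F.obj V.base) (f : U ⟶ V)
      (e : x ≫ F.map f.base = x'), G.map (lanHom F x x' f e) ≫ t (lanObj F V x') =
        t (lanObj F U x) ≫ G'.map (lanHom F x x' f e)) {z z' : (lan F E).obj ⟨op d⟩} (f : z ⟶ z') :
    G.map f ≫ t z' = t z ≫ G'.map f :=
  (locTrans (W := fibreW (forget E ⋙ F) (totalCart E) d) (G := G) (G' := G')
    (fun X => t (lanObj F X.right X.hom))
    (fun {X Y} f => h X.hom Y.hom f.right (StructuredArrow.w f))).naturality f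

theorem fibreComparison_isInvertedBy (γ : E ⟶ restrict F M) (d : D) :
    (fibreW (forget E ⋙ F) (totalCart E) d).IsInvertedBy (fibreComparison F γ d) := by
  intro X Y f hf
  have : IsIso f.right.fiber := (isCart_forget_iff f.right).1 hf
  have h₁ : IsIso ((fibreMap γ X.right.base).map f.right.fiber ≫
    cell γ f.right.base Y.right.fiber) :=
    @IsIso.comp_isIso _ _ _ _ _ _ _ (Functor.map_isIso _ _) (isIso_cell γ _ _)
  have h₂ : IsIso ((pull M X.hom).map ((fibreMap γ X.right.base).map f.right.fiber ≫
    cell γ f.right.base Y.right.fiber)) := @Functor.map_isIso _ _ _ _ _ _ _ _ h₁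
  exact @IsIso.comp_isIso _ _ _ _ _ _ _ h₂
    (isIso_glue M X.hom (F.map f.right.base) Y.hom (StructuredArrow.w f) _)

/-- The functor from the fibre of `lan` over `d` induced by a transformation `E ⟶ F^* M`. -/
def transposeApp (γ : E ⟶ restrict F M) (d : D) : (lan F E).obj ⟨op d⟩ ⥤ M.obj ⟨op d⟩ :=
  Localization.Construction.lift (fibreComparison F γ d) (fibreComparison_isInvertedBy F γ d)

theorem transposeApp_map (γ : E ⟶ restrict F M) {d : D} {U V : ∫ᶜ E} (x : d ⟶ F.obj U.base)
    (x' : d ⟶ F.obj V.base) (f : U ⟶ V) (h : x ≫ F.map f.base = x') :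
    (transposeApp F γ d).map (lanHom F x x' f h) =
      (pull M x).map ((fibreMap γ U.base).map f.fiber ≫ cell γ f.base V.fiber) ≫
        glue M x (F.map f.base) x' h ((fibreMap γ V.base).obj V.fiber) :=
  lift_map_Q _ _ _

theorem transposeApp_map_id (γ : E ⟶ restrict F M) {d : D} {U : ∫ᶜ E} (x x' : d ⟶ F.obj U.base)
    (h : x ≫ F.map (𝟙 U : U ⟶ U).base = x') :
    (transposeApp F γ d).map (lanHom F x x' (𝟙 U) h) =
      rebase M x x' (by rw [← h, comp_map_id_base]) ((fibreMap γ U.base).obj U.fiber) := by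
  obtain rfl : x = x' := by rw [← h, comp_map_id_base]
  exact (congrArg _ (lanHom_id F x (𝟙 U) rfl h)).trans ((transposeApp F γ d).map_id _)

/-- The naturality isomorphism of the transpose of `E ⟶ F^* M`. -/
def transposeCell (γ : E ⟶ restrict F M) {X Y : D} (h : X ⟶ Y) (z : (lan F E).obj ⟨op Y⟩) :
    (transposeApp F γ X).obj ((pull (lan F E) h).obj z) ≅
      (pull M h).obj ((transposeApp F γ Y).obj z) :=
  unglue M h z.as.obj.hom ((fibreMap γ z.as.obj.right.base).obj z.as.obj.right.fiber)

theorem transposeCell_naturality (γ : E ⟶ restrict F M) {X Y : D} (h : X ⟶ Y)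
    {z z' : (lan F E).obj ⟨op Y⟩} (f : z ⟶ z') :
    (transposeApp F γ X).map ((pull (lan F E) h).map f) ≫ (transposeCell F γ h z').hom =
      (transposeCell F γ h z).hom ≫ (pull M h).map ((transposeApp F γ Y).map f) := by
  refine lan_naturality F (G := pull (lan F E) h ⋙ transposeApp F γ X)
    (G' := transposeApp F γ Y ⋙ pull M h) (fun z => (transposeCell F γ h z).hom) ?_ f
  intro U V x x' f e
  have e' : (h ≫ x) ≫ F.map f.base = h ≫ x' := by rw [Category.assoc, e]
  have h₁ := (congrArg (transposeApp F γ X).map (pull_lanHom F h x x' f e)).trans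
    (transposeApp_map F γ _ _ f e')
  have h₂ := congrArg (pull M h).map (transposeApp_map F γ x x' f e)
  exact ((congrArg (· ≫ _) h₁).trans (unglue_square M h x (F.map f.base) x' e e' _)).trans
    (congrArg (_ ≫ ·) h₂.symm)

/-- The transpose `lan ⟶ M` of a pseudonatural transformation `E ⟶ F^* M`. -/
def transpose (γ : E ⟶ restrict F M) : lan F E ⟶ M :=
  mkTrans (transposeApp F γ) (transposeCell F γ) (transposeCell_naturality F γ)
    (fun z => (congrArg (· ≫ _) ((congrArg _ (unitCell_lan F (𝟙 _) rfl
      (U := z.as.obj.right) z.as.obj.hom)).trans (transposeApp_map_id F γ _ _ _))).trans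
        (rebase_unglue M _ _))
    (fun h y z => (congrArg (· ≫ _) ((congrArg _ (glue_lan F h y (h ≫ y) rfl
      (U := z.as.obj.right) z.as.obj.hom)).trans (transposeApp_map_id F γ _ _ _))).trans
        (rebase_unglue_comp M _ _ _ _))

end Transpose

end

section

open Pseudofunctor Pseudofunctor.CoGrothendieck

section

variable {A : Type u₁} [Category.{v₁} A] {B : Type u₂} [Category.{v₂} B] {G : A ⥤ B}

theorem map_comp_square {a b a' b' : A} {k k' : B} {φ : a ⟶ b} {φ' : a' ⟶ b'} {n : a ⟶ a'}
    {m : b ⟶ b'} (h : φ ≫ m = n ≫ φ') {g : G.obj b ⟶ k} {g' : G.obj b' ⟶ k'} {q : k ⟶ k'}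
    (hq : G.map m ≫ g' = g ≫ q) : (G.map φ ≫ g) ≫ q = G.map n ≫ G.map φ' ≫ g' := by
  rw [Category.assoc, ← hq, ← G.map_comp_assoc, h, G.map_comp_assoc]

theorem square_comp_square {a b c a' b' c' : A} {f : a ⟶ b} {g : b ⟶ c} {f' : a' ⟶ b'}
    {g' : b' ⟶ c'} {x : a ⟶ a'} {y : b ⟶ b'} {z : c ⟶ c'} (h : f ≫ y = x ≫ f')
    (h' : g ≫ z = y ≫ g') : (f ≫ g) ≫ z = x ≫ f' ≫ g' := by
  rw [Category.assoc, h', ← Category.assoc, h, Category.assoc]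

theorem conj_square {p q p' q' z z' : A} {c : p ⟶ q} {c' : p' ⟶ q'} [IsIso c] [IsIso c']
    {r : q ⟶ q'} {s : p ⟶ p'} (h : c ≫ r = s ≫ c') {t : p ⟶ z} {t' : p' ⟶ z'} {u : z ⟶ z'}
    (h' : s ≫ t' = t ≫ u) : r ≫ inv c' ≫ t' = (inv c ≫ t) ≫ u := by
  rw [← cancel_epi c, ← Category.assoc, h, Category.assoc, IsIso.hom_inv_id_assoc, h',
    Category.assoc, IsIso.hom_inv_id_assoc]

theorem conj_map {a b' y z' : B} {p q z : A} {k : a ⟶ G.obj p} [IsIso k] {c : p ⟶ q} [IsIso c]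
    {s : p ⟶ z} {i : y ≅ G.obj q} {c' : b' ⟶ y} [IsIso c'] {l : a ⟶ b'} {t : b' ⟶ z'}
    {v : z' ⟶ G.obj z} (h : k ≫ G.map c ≫ i.inv = l ≫ c') (h' : l ≫ t ≫ v = k ≫ G.map s) :
    (inv c' ≫ t) ≫ v = i.hom ≫ G.map (inv c ≫ s) := by
  rw [← cancel_epi (k ≫ G.map c ≫ i.inv)]
  trans k ≫ G.map s
  · rw [h, ← h']
    simp
  · simp

theorem comp_map_comp_eq {G : A ⥤ A} {a b y z : A} {u : a ⟶ G.obj a} {u' : b ⟶ G.obj b}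
    {e c : a ⟶ b} (hu : c ≫ u' = u ≫ G.map c) (he : e = c) {g : G.obj b ⟶ y} {i : y ≅ z}
    {m : b ⟶ z} (h : u' ≫ g = m ≫ i.inv) : u ≫ (G.map e ≫ g) ≫ i.hom = c ≫ m := by
  rw [he, ← Category.assoc, ← Category.assoc, ← hu, Category.assoc c, h]
  simp

end

section Elementwise

variable {D : Type u₂} [Category.{v₂} D] {L M : LocallyDiscrete Dᵒᵖ ⥤ᵖ Cat.{w, w}}

/-- Compatibility of a pseudonatural transformation with the action of a Grothendieck construction
on arrows. -/
theorem cell_transport (β : L ⟶ M) {X Y Z : D} (x : X ⟶ Y) (y : Y ⟶ Z) (k : X ⟶ Z)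
    (hk : x ≫ y = k) {u : L.obj ⟨op Y⟩} {v : L.obj ⟨op Z⟩} (κ : u ⟶ (pull L y).obj v) :
    cell β x u ≫ (pull M x).map ((fibreMap β Y).map κ ≫ cell β y v) ≫
        glue M x y k hk ((fibreMap β Z).obj v) =
      (fibreMap β X).map ((pull L x).map κ ≫ glue L x y k hk v) ≫ cell β k v := by
  rw [Functor.map_comp, Functor.map_comp]
  refine Eq.trans ?_ (Category.assoc _ _ _).symm
  refine Eq.trans ?_ (congrArg (_ ≫ ·) (cell_glue β x y k hk v).symm)
  refine (congrArg (_ ≫ ·) (Category.assoc _ _ _)).trans ?_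
  refine (Category.assoc _ _ _).symm.trans (Eq.trans ?_ (Category.assoc _ _ _))
  exact congrArg (· ≫ _) (cell_naturality β x κ).symm

variable (M) in
/-- `unitCell`, as an isomorphism. -/
def unitCellIso (X : D) (x : M.obj ⟨op X⟩) : x ≅ (pull M (𝟙 X)).obj x :=
  @asIso _ _ _ _ (unitCell M (𝟙 X) rfl x) (isIso_unitCell M (𝟙 X) rfl x)

end Elementwise

section Transpose

variable {C : Type u₁} [Category.{v₁} C] {D : Type u₂} [Category.{v₂} D] (F : C ⥤ D)
  {E : LocallyDiscrete Cᵒᵖ ⥤ᵖ Cat.{max w u₁ v₁ v₂, max w u₁ v₁ v₂}}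
  {M : LocallyDiscrete Dᵒᵖ ⥤ᵖ Cat.{max w u₁ v₁ v₂, max w u₁ v₁ v₂}}

/-- The action of the transposition on modifications, fibrewise. -/
def transposeMapApp {γ γ' : E ⟶ restrict F M} (n : γ ⟶ γ') (d : D) :
    transposeApp F γ d ⟶ transposeApp F γ' d where
  app z := (pull M z.as.obj.hom).map ((modApp n z.as.obj.right.base).app z.as.obj.right.fiber)
  naturality z z' f := by
    refine lan_naturality F (G := transposeApp F γ d) (G' := transposeApp F γ' d)
      (fun z => (pull M z.as.obj.hom).map
        ((modApp n z.as.obj.right.base).app z.as.obj.right.fiber)) ?_ f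
    intro U V x x' f e
    refine (congrArg (· ≫ _) (transposeApp_map F γ x x' f e)).trans
      (Eq.trans ?_ (congrArg (_ ≫ ·) (transposeApp_map F γ' x x' f e)).symm)
    exact map_comp_square (square_comp_square
        ((modApp n U.base).naturality f.fiber) (modApp_cell n f.base V.fiber).symm)
      (glue_naturality M x (F.map f.base) x' e ((modApp n V.base).app V.fiber))

/-- The action of the transposition on modifications. -/
def transposeMap {γ γ' : E ⟶ restrict F M} (n : γ ⟶ γ') : transpose F γ ⟶ transpose F γ' :=
  mkModification (transposeMapApp F n) (fun h z =>
    unglue_naturality M h z.as.obj.hom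
      ((modApp n z.as.obj.right.base).app z.as.obj.right.fiber))

variable (E M) in
/-- Transposition, as a functor. -/
def transposeFunctor : (E ⟶ restrict F M) ⥤ (lan F E ⟶ M) where
  obj γ := transpose F γ
  map n := transposeMap F n
  map_id _ := modification_ext fun _ z => (pull M z.as.obj.hom).map_id _
  map_comp _ _ := modification_ext fun _ z => (pull M z.as.obj.hom).map_comp _ _

variable (E M) in
/-- The functor `β ↦ F^*(β) ∘ η` for the unit `η` of `lan`. -/
abbrev restrictAlongUnit : (lan F E ⟶ M) ⥤ (E ⟶ restrict F M) :=
  restrictFunctor F (lan F E) M ⋙ Bicategory.precomp (restrict F M) (lanUnit F E)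

theorem transposeApp_map_vert (γ : E ⟶ restrict F M) {X : C} {U V : E.obj ⟨op X⟩} (u : U ⟶ V) :
    (transposeApp F γ (F.obj X)).map (lanHom F (U := ⟨X, U⟩) (V := ⟨X, V⟩) (𝟙 _) (𝟙 _) (vert X u)
      (id_comp_map_vert F u)) = (pull M (𝟙 (F.obj X))).map ((fibreMap γ X).map u) := by
  refine (transposeApp_map F γ _ _ _ _).trans ?_
  have h₁ : (fibreMap γ X).map (vert X u : (⟨X, U⟩ : ∫ᶜ E) ⟶ ⟨X, V⟩).fiber ≫ cell γ (𝟙 X) V =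
      (fibreMap γ X).map u ≫ unitCell M (F.map (𝟙 X)) (F.map_id X) ((fibreMap γ X).obj V) := by
    refine (congrArg (· ≫ _) (((fibreMap γ X).map_comp _ _))).trans
      ((Category.assoc _ _ _).trans (congrArg (_ ≫ ·) ?_))
    refine Eq.trans ?_ (unitCell_restrict F (𝟙 X) rfl ((fibreMap γ X).obj V))
    refine Eq.trans ?_ (cell_unitCell γ (𝟙 X) rfl V)
    exact congrArg (fun t => (fibreMap γ X).map t ≫ _) (unitCell_rfl E V).symm
  refine (congrArg (fun t => (pull M (𝟙 (F.obj X))).map t ≫ _) h₁).trans ?_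
  refine (congrArg (· ≫ _) ((pull M (𝟙 (F.obj X))).map_comp _ _)).trans ?_
  refine (Category.assoc _ _ _).trans ((congrArg (_ ≫ ·) (map_unitCell_glue M (𝟙 (F.obj X))
    (F.map (𝟙 X)) (F.map_id X) _ ((fibreMap γ X).obj V))).trans ?_)
  exact Category.comp_id _

theorem cell_restrictAlongUnit_transpose (γ : E ⟶ restrict F M) {X Y : C} (h : X ⟶ Y)
    (U : E.obj ⟨op Y⟩) :
    cell ((restrictAlongUnit F E M).obj (transpose F γ)) h U =
      ((pull M (𝟙 (F.obj X))).map ((fibreMap γ X).map (𝟙 _) ≫ cell γ h U) ≫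
        glue M (𝟙 (F.obj X)) (F.map h) (F.map h ≫ 𝟙 _)
          ((Category.id_comp _).trans (Category.comp_id _).symm) ((fibreMap γ Y).obj U)) ≫
        (unglue M (F.map h) (𝟙 (F.obj Y)) ((fibreMap γ Y).obj U)).hom :=
  (cell_comp (lanUnit F E) ((restrictFunctor F (lan F E) M).obj (transpose F γ)) h U).trans
    (congrArg (· ≫ _) (transposeApp_map F γ (U := ⟨X, (pull E h).obj U⟩) (V := ⟨Y, U⟩) _ _
      (cartArrow h U) _))

theorem map_id_comp_cell (γ : E ⟶ restrict F M) {X Y : C} (h : X ⟶ Y) (U : E.obj ⟨op Y⟩) :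
    (fibreMap γ X).map (𝟙 _) ≫ cell γ h U = cell γ h U :=
  (congrArg (· ≫ _) ((fibreMap γ X).map_id _)).trans (Category.id_comp _)

/-- Transposing and restricting along the unit gives back the original transformation. -/
def restrictTransposeIso (γ : E ⟶ restrict F M) :
    γ ≅ (restrictAlongUnit F E M).obj (transpose F γ) :=
  mkModIso (fun X => NatIso.ofComponents
      (fun U => unitCellIso M (F.obj X) ((fibreMap γ X).obj U))
      (fun u => (unitCell_naturality M (𝟙 (F.obj X)) rfl ((fibreMap γ X).map u)).trans
        (congrArg (_ ≫ ·) (transposeApp_map_vert F γ u).symm)))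
    (fun {X Y} h U => by
      refine (congrArg (_ ≫ ·) (cell_restrictAlongUnit_transpose F γ h U)).trans ?_
      exact comp_map_comp_eq (unitCell_naturality M (𝟙 (F.obj X)) rfl (cell γ h U))
        (map_id_comp_cell F γ h U)
        (unitCell_glue_swap M (𝟙 (F.obj X)) rfl (F.map h) (𝟙 (F.obj Y)) rfl _ _ rfl
          ((fibreMap γ Y).obj U)))

/-- The canonical arrow from the reindexing along `x` of the object of `lan` represented by an
identity to the object represented by `x`. It is invertible. -/
def lanObjHom {d : D} (U : ∫ᶜ E) (x : d ⟶ F.obj U.base) :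
    (pull (lan F E) x).obj (lanObj F U (𝟙 _)) ⟶ lanObj F U x :=
  lanHom F (x ≫ 𝟙 _) x (𝟙 U) ((comp_map_id_base F _).trans (Category.comp_id x))

theorem isIso_lanObjHom {d : D} (U : ∫ᶜ E) (x : d ⟶ F.obj U.base) :
    IsIso (lanObjHom F U x) :=
  isIso_lanHom F _ _ _ _ (isCart_of_isIso (forget E) (𝟙 U))

/-- The arrow of the fibre of `lan` over `F X` represented by an arrow `f : (X, U) ⟶ (Y, V)` of
`∫ᶜ E`, from the object represented by the identity of `F X` to the reindexing along `F f` of the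
one represented by the identity of `F Y`. -/
def unitHom {U V : ∫ᶜ E} (f : U ⟶ V) :
    lanObj F U (𝟙 _) ⟶ (pull (lan F E) (F.map f.base)).obj (lanObj F V (𝟙 _)) :=
  lanHom F (𝟙 _) (F.map f.base ≫ 𝟙 _) f ((Category.id_comp _).trans (Category.comp_id _).symm)

theorem map_fiber_comp_cell_restrict (β : lan F E ⟶ M) {U V : ∫ᶜ E} (f : U ⟶ V) :
    (fibreMap ((restrictAlongUnit F E M).obj β) U.base).map f.fiber ≫
        cell ((restrictAlongUnit F E M).obj β) f.base V.fiber =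
      (fibreMap β (F.obj U.base)).map (unitHom F f) ≫
        cell β (F.map f.base) (lanObj F V (𝟙 _)) := by
  refine (congrArg (_ ≫ ·) (cell_comp (lanUnit F E)
    ((restrictFunctor F (lan F E) M).obj β) f.base V.fiber)).trans ?_
  refine (Category.assoc _ _ _).symm.trans (congrArg (· ≫ _) ?_)
  refine ((fibreMap β (F.obj U.base)).map_comp _ _).symm.trans
    (congrArg (fibreMap β (F.obj U.base)).map ?_)
  exact lanHom_comp F _ _ _ _ _ _ _ _ (vert_comp_cartArrow f)

/-- The isomorphism `M(x)(β U) ≅ β(x, U)` expressing `β` at the object represented by `x` through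
its value at the object represented by an identity. -/
def transposeRestrictApp (β : lan F E ⟶ M) {d : D} (U : ∫ᶜ E) (x : d ⟶ F.obj U.base) :
    (pull M x).obj ((fibreMap β (F.obj U.base)).obj (lanObj F U (𝟙 _))) ≅
      (fibreMap β d).obj (lanObj F U x) :=
  have := isIso_lanObjHom F U x
  (@asIso _ _ _ _ (cell β x (lanObj F U (𝟙 _))) (isIso_cell β x _)).symm ≪≫
    (fibreMap β d).mapIso (asIso (lanObjHom F U x))

theorem transposeRestrictApp_naturality (β : lan F E ⟶ M) {d : D} {U V : ∫ᶜ E}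
    (x : d ⟶ F.obj U.base) (x' : d ⟶ F.obj V.base) (f : U ⟶ V) (e : x ≫ F.map f.base = x') :
    (transposeApp F ((restrictAlongUnit F E M).obj β) d).map (lanHom F x x' f e) ≫
        (transposeRestrictApp F β V x').hom =
      (transposeRestrictApp F β U x).hom ≫ (fibreMap β d).map (lanHom F x x' f e) := by
  have h₁ : (pull (lan F E) x).map (unitHom F f) ≫
      glue (lan F E) x (F.map f.base) x' e (lanObj F V (𝟙 _)) = lanHom F (x ≫ 𝟙 _) (x' ≫ 𝟙 _) f
        (by rw [Category.comp_id, Category.comp_id, e]) :=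
    (congrArg (_ ≫ ·) (glue_lan F x (F.map f.base) x' e (𝟙 _))).trans
      ((congrArg (· ≫ _) (pull_lanHom F x _ _ f _)).trans
        (lanHom_comp F _ _ _ _ _ _ _ _ (Category.comp_id f)))
  have h₂ := (congrArg (_ ≫ ·)
    (transposeApp_map F ((restrictAlongUnit F E M).obj β) x x' f e)).trans
    ((congrArg (fun t => cell β x (lanObj F U (𝟙 _)) ≫ (pull M x).map t ≫ _)
      (map_fiber_comp_cell_restrict F β f)).trans
        ((cell_transport β x (F.map f.base) x' e (unitHom F f)).trans
          (congrArg (fun t => (fibreMap β d).map t ≫ _) h₁)))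
  refine @conj_square _ _ _ _ _ _ _ _ _ _ (isIso_cell β x _) (isIso_cell β x' _) _ _ h₂ _ _ _ ?_
  refine ((fibreMap β d).map_comp _ _).symm.trans (Eq.trans (congrArg (fibreMap β d).map ?_)
    ((fibreMap β d).map_comp _ _))
  exact (lanHom_comp F _ _ _ _ _ _ _ _ (Category.comp_id f)).trans
    (lanHom_comp F _ _ _ _ _ _ _ _ (Category.id_comp f)).symm

end Transpose

end

/-! ### The universal property for indexed categories -/

section

open Pseudofunctor Pseudofunctor.CoGrothendieck

theorem comp_inv_eq_inv_comp {A : Type u₁} [Category.{v₁} A] {a b a' b' : A} {i : a ≅ a'}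
    {j : b ≅ b'} {f : a ⟶ b} {g : a' ⟶ b'} (h : f ≫ j.hom = i.hom ≫ g) :
    g ≫ j.inv = i.inv ≫ f := by
  rw [Iso.comp_inv_eq, Category.assoc, h, Iso.inv_hom_id_assoc]

section

variable {C : Type u₁} [Category.{v₁} C] {D : Type u₂} [Category.{v₂} D] (F : C ⥤ D)
  {E : LocallyDiscrete Cᵒᵖ ⥤ᵖ Cat.{max w u₁ v₁ v₂, max w u₁ v₁ v₂}}
  {M : LocallyDiscrete Dᵒᵖ ⥤ᵖ Cat.{max w u₁ v₁ v₂, max w u₁ v₁ v₂}}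

theorem transposeRestrictApp_cell (β : lan F E ⟶ M) {X Y : D} (h : X ⟶ Y) (U : ∫ᶜ E)
    (x : Y ⟶ F.obj U.base) :
    (transposeRestrictApp F β U (h ≫ x)).hom ≫ cell β h (lanObj F U x) =
      (unglue M h x ((fibreMap β (F.obj U.base)).obj (lanObj F U (𝟙 _)))).hom ≫
        (pull M h).map (transposeRestrictApp F β U x).hom := by
  have h₁ := cell_glue β h x (h ≫ x) rfl (lanObj F U (𝟙 _))
  refine @conj_map _ _ _ _ (pull M h) _ _ _ _ _ _ _ _ (isIso_cell β h _) _ (isIso_cell β x _) _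
    (unglue M h x _) _ (isIso_cell β (h ≫ x) _) _ _ _ h₁.symm ?_
  refine Eq.trans ?_ (cell_naturality β h (lanObjHom F U x))
  refine (Category.assoc _ _ _).symm.trans (congrArg (· ≫ _) ?_)
  refine ((fibreMap β X).map_comp _ _).symm.trans (congrArg (fibreMap β X).map ?_)
  refine (congrArg (· ≫ _) (glue_lan F h x (h ≫ x) rfl (𝟙 _))).trans ?_
  exact (lanHom_comp F _ _ _ _ _ _ _ _ (Category.comp_id _)).trans (pull_lanHom F h _ _ _ _).symm

/-- Restricting along the unit and transposing gives back the original transformation. -/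
def transposeRestrictIso (β : lan F E ⟶ M) :
    transpose F ((restrictAlongUnit F E M).obj β) ≅ β :=
  mkModIso (fun d => NatIso.ofComponents
      (fun z => transposeRestrictApp F β z.as.obj.right z.as.obj.hom)
      (fun f => lan_naturality F
        (G := transposeApp F ((restrictAlongUnit F E M).obj β) d) (G' := fibreMap β d)
        (fun z => (transposeRestrictApp F β z.as.obj.right z.as.obj.hom).hom)
        (fun x x' f e => transposeRestrictApp_naturality F β x x' f e) f))
    (fun h z => (transposeRestrictApp_cell F β h z.as.obj.right z.as.obj.hom).symm.symm)

theorem transposeRestrictIso_naturality {β β' : lan F E ⟶ M} (m : β ⟶ β') :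
    transposeMap F ((restrictAlongUnit F E M).map m) ≫ (transposeRestrictIso F β').hom =
      (transposeRestrictIso F β).hom ≫ m := by
  refine modification_ext fun d z => ?_
  have h₁ := modApp_cell m z.as.obj.hom (lanObj F z.as.obj.right (𝟙 _))
  refine @conj_square _ _ _ _ _ _ _ _ _ _ (isIso_cell β z.as.obj.hom _)
    (isIso_cell β' z.as.obj.hom _) _ _ h₁.symm _ _ _ ?_
  exact ((modApp m d).naturality (lanObjHom F z.as.obj.right z.as.obj.hom)).symm

theorem restrictTransposeIso_naturality {γ γ' : E ⟶ restrict F M} (n : γ ⟶ γ') :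
    n ≫ (restrictTransposeIso F γ').hom =
      (restrictTransposeIso F γ).hom ≫ (restrictAlongUnit F E M).map (transposeMap F n) :=
  modification_ext fun X U => unitCell_naturality M (𝟙 (F.obj X)) rfl ((modApp n X).app U)

variable (E) in
/-- The fibrewise localization is the inverse image. -/
theorem isIndexedInverseImage_lan : IsIndexedInverseImage F E (lan F E) (lanUnit F E) := fun M =>
  (CategoryTheory.Equivalence.mk (restrictAlongUnit F E M) (transposeFunctor F E M)
    (NatIso.ofComponents (fun β => (transposeRestrictIso F β).symm)
      (fun m => comp_inv_eq_inv_comp (transposeRestrictIso_naturality F m)))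
    (NatIso.ofComponents (fun γ => (restrictTransposeIso F γ).symm)
      (fun n => comp_inv_eq_inv_comp (restrictTransposeIso_naturality F n)))).isEquivalence_functor

end

section

variable {C : Type u₁} [Category.{v₁} C] {D : Type u₂} [Category.{v₂} D] (F : C ⥤ D)
  {E : LocallyDiscrete Cᵒᵖ ⥤ᵖ Cat.{w, w}} {L L' : LocallyDiscrete Dᵒᵖ ⥤ᵖ Cat.{w, w}}

variable {F}

/-- A comparison between two inverse images followed by one in the other direction is isomorphic
to the identity, by full faithfulness of `β ↦ F^*(β) ∘ η`. -/
theorem IsIndexedInverseImage.nonempty_iso_id {η : E ⟶ restrict F L}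
    {η' : E ⟶ restrict F L'} (hη : IsIndexedInverseImage F E L η) (b : L ⟶ L') (b' : L' ⟶ L)
    (e : η ≫ (restrictFunctor F L L').obj b ≅ η') (e' : η' ≫ (restrictFunctor F L' L).obj b' ≅ η) :
    Nonempty (b ≫ b' ≅ 𝟙 L) := by
  have := hη L
  -- `F^*(b ≫ b')` and `F^*(b) ≫ F^*(b')` agree definitionally, and so do `F^*(𝟙)` and `𝟙`.
  exact ⟨(restrictFunctor F L L ⋙ Bicategory.precomp (restrict F L) η).preimageIso
    ((α_ η ((restrictFunctor F L L').obj b) ((restrictFunctor F L' L).obj b')).symm ≪≫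
      whiskerRightIso e ((restrictFunctor F L' L).obj b') ≪≫ e' ≪≫ (ρ_ η).symm)⟩

/-- An invertible modification gives natural isomorphisms between the component functors. -/
def fibreIso {β γ : L ⟶ L'} (i : β ≅ γ) (d : D) : fibreMap β d ≅ fibreMap γ d where
  hom := modApp i.hom d
  inv := modApp i.inv d
  hom_inv_id := congrArg (fun m => modApp m d) i.hom_inv_id
  inv_hom_id := congrArg (fun m => modApp m d) i.inv_hom_id

/-- A comparison between two inverse images compatible with the units is fibrewise an
equivalence. -/
theorem IsIndexedInverseImage.isEquivalence {η : E ⟶ restrict F L}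
    {η' : E ⟶ restrict F L'} (hη : IsIndexedInverseImage F E L η)
    (hη' : IsIndexedInverseImage F E L' η') (b : L ⟶ L')
    (e : η ≫ (restrictFunctor F L L').obj b ≅ η') (d : D) : (fibreMap b d).IsEquivalence := by
  have := hη' L
  let e' := (restrictFunctor F L' L ⋙ Bicategory.precomp (restrict F L) η').objObjPreimageIso η
  obtain ⟨i⟩ := hη.nonempty_iso_id b _ e e'
  obtain ⟨j⟩ := hη'.nonempty_iso_id _ b e' e
  exact (CategoryTheory.Equivalence.mk (fibreMap b d) _ (fibreIso i d).symm
    (fibreIso j d)).isEquivalence_functor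

end

section

variable {C : Type u₁} [Category.{v₁} C] {D : Type u₂} [Category.{v₂} D] {F : C ⥤ D}
  {E : LocallyDiscrete Cᵒᵖ ⥤ᵖ Cat.{max w u₁ v₁ v₂, max w u₁ v₁ v₂}}
  {L : LocallyDiscrete Dᵒᵖ ⥤ᵖ Cat.{max w u₁ v₁ v₂, max w u₁ v₁ v₂}}

/-- The comparison functors into the fibres of any inverse image are localizations: they factor
through the fibres of `lan` by the transpose of the unit, which is fibrewise an equivalence. -/
theorem IsIndexedInverseImage.isLocalization {η : E ⟶ restrict F L}
    (hη : IsIndexedInverseImage F E L η) (d : D) :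
    (fibreComparison F η d).IsLocalization (fibreCart F E d) := by
  have : (transposeApp F η d).IsEquivalence :=
    (isIndexedInverseImage_lan F E).isEquivalence hη (transpose F η)
      (restrictTransposeIso F η).symm d
  let W := fibreW (forget E ⋙ F) (totalCart E) d
  exact Functor.IsLocalization.of_equivalence_target W.Q W (fibreComparison F η d)
    (transposeApp F η d).asEquivalence
    (eqToIso (Localization.Construction.fac (fibreComparison F η d)
      (fibreComparison_isInvertedBy F η d)))

end

end

/-! ### The total category of the fibrewise localization -/

section

open Pseudofunctor Pseudofunctor.CoGrothendieck

section

variable {P : Type u₁} [Category.{v₁} P] {D : Type u₂} [Category.{v₂} D] (H : P ⥤ D)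
  (W : MorphismProperty P)

/-- The arrows of `(1_D ↓ H)` with invertible component in `D` and component in `P` lying in
`W`. -/
def vertW : MorphismProperty (Comma (𝟭 D) H) :=
  fun _ _ f => IsIso ((Comma.fst (𝟭 D) H).map f) ∧ W f.right

theorem locHom_comp_map_locHom {d d' d'' : D} (e : d ⟶ d') (e' : d' ⟶ d'') {U V Z : P}
    (x : d ⟶ H.obj U) (y : d' ⟶ H.obj V) (z : d'' ⟶ H.obj Z) (a : U ⟶ V)
    (b : V ⟶ Z) (k : U ⟶ Z) (ha : x ≫ H.map a = e ≫ y) (hb : y ≫ H.map b = e' ≫ z)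
    (hk : a ≫ b = k) :
    locHom H W x (e ≫ y) a ha ≫ ((locIndexed H W).map e.op.toLoc).toFunctor.map
        (locHom H W y (e' ≫ z) b hb) ≫
        ((locIndexed H W).mapComp e'.op.toLoc e.op.toLoc).inv.toNatTrans.app (locObj H W z) =
      locHom H W x ((e ≫ e') ≫ z) k
        (by rw [← hk, H.map_comp, reassoc_of% ha, hb, Category.assoc]) := by
  subst hk
  have h₁ : (e ≫ e' ≫ z) ≫ H.map (𝟙 Z) = (e ≫ e') ≫ z := by simp
  refine (congrArg (_ ≫ ·) ((congrArg (· ≫ _) (map_locHom H W e _ _ b hb)).trans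
    (locHom_comp H W _ _ _ b (𝟙 Z) _ h₁))).trans ((locHom_comp H W _ _ _ _ _ _ _).trans ?_)
  congr 1
  rw [Category.comp_id]

/-- The canonical functor from `(1_D ↓ H)` to the total category of the fibrewise localization. -/
def toTotal : Comma (𝟭 D) H ⥤ ∫ᶜ (locIndexed H W) where
  obj A := ⟨A.left, locObj H W A.hom⟩
  map {A B} f := ⟨f.left, locHom H W A.hom (f.left ≫ B.hom) f.right f.w.symm⟩
  map_id A := congrArg (fun t => (⟨𝟙 A.left, t⟩ : (⟨A.left, locObj H W A.hom⟩ :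
    ∫ᶜ (locIndexed H W)) ⟶ ⟨A.left, locObj H W A.hom⟩)) (mapId_inv_app_locObj H W A.hom).symm
  map_comp {A B Z} f g := by
    exact congrArg (fun t => (⟨f.left ≫ g.left, t⟩ : (⟨A.left, locObj H W A.hom⟩ :
      ∫ᶜ (locIndexed H W)) ⟶ ⟨Z.left, locObj H W Z.hom⟩))
        (locHom_comp_map_locHom H W f.left g.left A.hom B.hom Z.hom f.right g.right _
          f.w.symm g.w.symm rfl).symm

theorem isIso_toTotal_map {A B : Comma (𝟭 D) H} (f : A ⟶ B) (hf : vertW H W f) :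
    IsIso ((toTotal H W).map f) := by
  have h₁ : IsIso ((forget (locIndexed H W)).map ((toTotal H W).map f)) := hf.1
  have h₂ : IsCart (forget (locIndexed H W)) ((toTotal H W).map f) :=
    (isCart_forget_iff _).2 (isIso_locHom H W _ _ _ _ hf.2)
  exact h₂.isIso

variable {H W} {T : Type u₃} [Category.{v₃} T] {G : Comma (𝟭 D) H ⥤ T}

/-- The inclusion of `(d ↓ H)` in `(1_D ↓ H)`. -/
def fibreIncl (H : P ⥤ D) (d : D) : StructuredArrow d H ⥤ Comma (𝟭 D) H where
  obj x := ⟨d, x.right, x.hom⟩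
  map {x y} f := { left := 𝟙 d, right := f.right, w := by simp }

/-- The arrow `(e, 1)` of `(1_D ↓ H)`. -/
def liftArrow (H : P ⥤ D) {d d' : D} (e : d ⟶ d') {U : P} (x : d' ⟶ H.obj U) :
    (⟨d, U, e ≫ x⟩ : Comma (𝟭 D) H) ⟶ ⟨d', U, x⟩ where
  left := e
  right := 𝟙 U
  w := by simp

/-- The arrow `(1, a)` of `(1_D ↓ H)`. -/
def vertArrow (H : P ⥤ D) {d : D} {U V : P} (x : d ⟶ H.obj U) (x' : d ⟶ H.obj V) (a : U ⟶ V)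
    (h : x ≫ H.map a = x') : (⟨d, U, x⟩ : Comma (𝟭 D) H) ⟶ ⟨d, V, x'⟩ where
  left := 𝟙 d
  right := a
  w := by simp [h]



theorem vertArrow_comp_liftArrow {d d' : D} (e : d ⟶ d') {U V : P} (x : d' ⟶ H.obj U)
    (x' : d' ⟶ H.obj V) (a : U ⟶ V) (h : x ≫ H.map a = x') :
    vertArrow H (e ≫ x) (e ≫ x') a (by rw [Category.assoc, h]) ≫ liftArrow H e x' =
      liftArrow H e x ≫ vertArrow H x x' a h :=
  Comma.hom_ext _ _ ((Category.id_comp _).trans (Category.comp_id _).symm)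
    ((Category.comp_id _).trans (Category.id_comp _).symm)

theorem vertArrow_comp_liftArrow_comp {a b c : D} (h : a ⟶ b) (y : b ⟶ c) {U : P}
    (x : c ⟶ H.obj U) :
    vertArrow H (h ≫ y ≫ x) ((h ≫ y) ≫ x) (𝟙 U) (by simp) ≫ liftArrow H (h ≫ y) x =
      liftArrow H h (y ≫ x) ≫ liftArrow H y x :=
  Comma.hom_ext _ _ (Category.id_comp _) rfl

theorem vertArrow_comp_liftArrow_id {d : D} {U : P} (x : d ⟶ H.obj U) :
    vertArrow H x (𝟙 d ≫ x) (𝟙 U) (by simp) ≫ liftArrow H (𝟙 d) x = 𝟙 _ :=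
  Comma.hom_ext _ _ (Category.id_comp _) (Category.id_comp _)

theorem vertArrow_comp_liftArrow_eq {A B : Comma (𝟭 D) H} (f : A ⟶ B) :
    vertArrow H A.hom (f.left ≫ B.hom) f.right f.w.symm ≫ liftArrow H f.left B.hom = f :=
  Comma.hom_ext _ _ (Category.id_comp _) (Category.comp_id _)

variable (hG : (vertW H W).IsInvertedBy G)

/-- The restriction of a functor out of `(1_D ↓ H)` to the fibres, extended to their
localizations. -/
def fromFibre (d : D) : (fibreW H W d).Localization ⥤ T :=
  Localization.Construction.lift (fibreIncl H d ⋙ G)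
    (fun _ _ _ hf => hG _ ⟨inferInstanceAs (IsIso (𝟙 d)), hf⟩)

theorem fromFibre_map {d : D} {U V : P} (x : d ⟶ H.obj U) (x' : d ⟶ H.obj V) (a : U ⟶ V)
    (h : x ≫ H.map a = x') :
    (fromFibre hG d).map (locHom H W x x' a h) = G.map (vertArrow H x x' a h) :=
  lift_map_Q _ _ _

/-- The comparison between `fromFibre` over different objects of the base. -/
def fromFibreLift {d d' : D} (e : d ⟶ d') : locMap H W e ⋙ fromFibre hG d ⟶ fromFibre hG d' :=
  locTrans (fun X => G.map (liftArrow H e X.hom)) (fun {X Y} f => by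
    have h₁ := (congrArg (fromFibre hG d).map (map_locHom H W e X.hom Y.hom f.right
      (StructuredArrow.w f))).trans (fromFibre_map hG _ _ _ _)
    have h₂ := fromFibre_map hG X.hom Y.hom f.right (StructuredArrow.w f)
    refine (congrArg (· ≫ _) h₁).trans (Eq.trans ?_ (congrArg (_ ≫ ·) h₂.symm))
    exact (G.map_comp _ _).symm.trans ((congrArg G.map (vertArrow_comp_liftArrow e X.hom Y.hom
      f.right (StructuredArrow.w f))).trans (G.map_comp _ _)))

/-- The extension to the total category of the fibrewise localization of a functor out of
`(1_D ↓ H)`. -/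
def fromTotal : ∫ᶜ (locIndexed H W) ⥤ T where
  obj z := (fromFibre hG z.base).obj z.fiber
  map {z z'} f := (fromFibre hG z.base).map f.fiber ≫ (fromFibreLift hG f.base).app z'.fiber
  map_id z := by
    have h₁ : z.fiber.as.obj.hom ≫ H.map (𝟙 _) = 𝟙 z.base ≫ z.fiber.as.obj.hom := by simp
    refine (congrArg (· ≫ _) (fromFibre_map hG _ _ (𝟙 _) h₁)).trans ((G.map_comp _ _).symm.trans ?_)
    exact (congrArg G.map (vertArrow_comp_liftArrow_id z.fiber.as.obj.hom)).trans (G.map_id _)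
  map_comp {z z' z''} f g := by
    refine (congrArg (· ≫ _) (((fromFibre hG z.base).map_comp _ _).trans
      (congrArg (_ ≫ ·) ((fromFibre hG z.base).map_comp _ _)))).trans ?_
    refine (Category.assoc _ _ _).trans (Eq.trans (congrArg (_ ≫ ·) ?_) (Category.assoc _ _ _).symm)
    refine (Category.assoc _ _ _).trans ?_
    refine Eq.trans (congrArg (_ ≫ ·) ?_) ((Category.assoc _ _ _).symm.trans
      ((congrArg (· ≫ _) ((fromFibreLift hG f.base).naturality g.fiber)).trans
        (Category.assoc _ _ _)))
    have h₁ : (f.base ≫ g.base ≫ z''.fiber.as.obj.hom) ≫ H.map (𝟙 _) =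
      (f.base ≫ g.base) ≫ z''.fiber.as.obj.hom := by simp
    refine (congrArg (· ≫ _) (fromFibre_map hG _ _ (𝟙 _) h₁)).trans ((G.map_comp _ _).symm.trans ?_)
    exact (congrArg G.map (vertArrow_comp_liftArrow_comp f.base g.base
      z''.fiber.as.obj.hom)).trans (G.map_comp _ _)

/-- `fromTotal` extends the given functor. -/
def toTotalFromTotal : toTotal H W ⋙ fromTotal hG ≅ G :=
  NatIso.ofComponents (fun A => Iso.refl (G.obj A)) (fun {A B} f => by
    refine (Category.comp_id _).trans (Eq.trans ?_ (Category.id_comp _).symm)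
    refine (congrArg (· ≫ _) (fromFibre_map hG _ _ _ f.w.symm)).trans
      ((G.map_comp _ _).symm.trans ?_)
    exact congrArg G.map (vertArrow_comp_liftArrow_eq f))

end

end

section

open Pseudofunctor Pseudofunctor.CoGrothendieck

section

variable {C : Type u₁} [Category.{v₁} C] (E : LocallyDiscrete Cᵒᵖ ⥤ᵖ Cat.{v₂, u₂})

/-- The inclusion of a fibre in the Grothendieck construction. -/
def vertFunctor (X : C) : E.obj ⟨op X⟩ ⥤ ∫ᶜ E where
  obj U := ⟨X, U⟩
  map u := vert X u
  map_id U := vert_id U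
  map_comp u v := (vert_comp_vert u v).symm

end

section

variable {P : Type u₁} [Category.{v₁} P] {D : Type u₂} [Category.{v₂} D] (H : P ⥤ D)
  (W : MorphismProperty P)

theorem toTotal_map_vertArrow {d : D} {U V : P} (x : d ⟶ H.obj U) (x' : d ⟶ H.obj V) (a : U ⟶ V)
    (h : x ≫ H.map a = x') :
    (toTotal H W).map (vertArrow H x x' a h) = vert d (locHom H W x x' a h) := by
  have h₁ : x' ≫ H.map (𝟙 V) = 𝟙 d ≫ x' := by simp
  refine congrArg (fun t => (⟨𝟙 d, t⟩ : (⟨d, locObj H W x⟩ : ∫ᶜ (locIndexed H W)) ⟶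
    ⟨d, locObj H W x'⟩)) (Eq.symm ((locHom_comp H W x x' _ a (𝟙 V) h h₁).trans ?_))
  congr 1
  exact Category.comp_id _

theorem toTotal_map_liftArrow {d d' : D} (e : d ⟶ d') {U : P} (x : d' ⟶ H.obj U) :
    (toTotal H W).map (liftArrow H e x) = cartArrow e (locObj H W x) :=
  congrArg (fun t => (⟨e, t⟩ : (⟨d, locObj H W (e ≫ x)⟩ : ∫ᶜ (locIndexed H W)) ⟶
    ⟨d', locObj H W x⟩)) (locHom_id H W (e ≫ x) (by simp))

theorem fromTotal_toTotal_map {T : Type u₃} [Category.{v₃} T] {G : Comma (𝟭 D) H ⥤ T}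
    (hG : (vertW H W).IsInvertedBy G) {A B : Comma (𝟭 D) H} (f : A ⟶ B) :
    (fromTotal hG).map ((toTotal H W).map f) = G.map f :=
  (Category.comp_id _).symm.trans
    (((toTotalFromTotal hG).hom.naturality f).trans (Category.id_comp _))

/-- The functor out of the localization of `(1_D ↓ H)` induced by `toTotal`. -/
def locToTotal : (vertW H W).Localization ⥤ ∫ᶜ (locIndexed H W) :=
  Localization.Construction.lift (toTotal H W) (fun _ _ f hf => isIso_toTotal_map H W f hf)

theorem locToTotal_map_fromFibre (d : D) {z z' : (locIndexed H W).obj ⟨op d⟩} (u : z ⟶ z') :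
    (locToTotal H W).map ((fromFibre (vertW H W).Q_inverts d).map u) = vert d u := by
  have := (locTrans (W := fibreW H W d)
    (G := fromFibre (vertW H W).Q_inverts d ⋙ locToTotal H W)
    (G' := vertFunctor (locIndexed H W) d) (fun X => 𝟙 _) (fun {X Y} f => by
      refine (Category.comp_id _).trans (Eq.trans ?_ (Category.id_comp _).symm)
      refine (congrArg (locToTotal H W).map (fromFibre_map (vertW H W).Q_inverts X.hom Y.hom f.right
        (StructuredArrow.w f))).trans ?_
      exact (lift_map_Q _ _ _).trans (toTotal_map_vertArrow H W _ _ _ _))).naturality u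
  exact (Category.comp_id _).symm.trans (this.trans (Category.id_comp _))

/-- The total category of the fibrewise localization is equivalent to the localization of
`(1_D ↓ H)`. -/
def totalEquivalence : (vertW H W).Localization ≌ ∫ᶜ (locIndexed H W) :=
  CategoryTheory.Equivalence.mk (locToTotal H W) (fromTotal (vertW H W).Q_inverts)
    (locIso (fun X => Iso.refl _) (fun f => by
      refine (Category.comp_id _).trans (Eq.trans ?_ (Category.id_comp _).symm)
      refine Eq.symm ((congrArg (fromTotal (vertW H W).Q_inverts).map (lift_map_Q _ _ f)).trans ?_)
      exact fromTotal_toTotal_map H W (vertW H W).Q_inverts f))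
    (NatIso.ofComponents (fun z => Iso.refl _) (fun {z z'} f => by
      refine (Category.comp_id _).trans (Eq.trans ?_ (Category.id_comp _).symm)
      refine ((locToTotal H W).map_comp _ _).trans (Eq.trans ?_ (vert_comp_cartArrow f))
      refine (congrArg (· ≫ _) (locToTotal_map_fromFibre H W z.base f.fiber)).trans
        (congrArg (_ ≫ ·) ?_)
      exact (lift_map_Q _ _ _).trans (toTotal_map_liftArrow H W f.base z'.fiber.as.obj.hom)))

instance isLocalization_toTotal : (toTotal H W).IsLocalization (vertW H W) :=
  Functor.IsLocalization.of_equivalence_target (vertW H W).Q (vertW H W) (toTotal H W)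
    (totalEquivalence H W) (eqToIso (Localization.Construction.fac (toTotal H W) _))

end

end

/-! ### Cartesian arrows in a localization of the generalized elements -/

section

open Pseudofunctor Pseudofunctor.CoGrothendieck

section

variable {D : Type u₂} [Category.{v₂} D] {R : Type u₅} [Category.{v₅} R]
  {Q : Type u₄} [Category.{v₄} Q]

theorem IsCart.of_iso {r r' : R ⥤ D} (i : r ≅ r') {a b : R} {f : a ⟶ b} (hf : IsCart r f) :
    IsCart r' f := by
  rw [isCart_iff] at hf ⊢
  intro c h g hg
  obtain ⟨k, ⟨hk, hk'⟩, hu⟩ := hf c h (i.hom.app c ≫ g ≫ i.inv.app a) (by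
    rw [← cancel_mono (i.hom.app b), NatTrans.naturality, hg]
    simp)
  refine ⟨k, ⟨?_, hk'⟩, ?_⟩
  · rw [← cancel_epi (i.hom.app c), ← NatTrans.naturality, hk]
    simp
  · rintro l ⟨hl, hl'⟩
    refine hu l ⟨?_, hl'⟩
    rw [← cancel_mono (i.hom.app a), NatTrans.naturality, hl]
    simp

/-- Fully faithful functors over `D` reflect cartesian arrows. -/
theorem isCart_comp_of_isCart_map (G : R ⥤ Q) [G.Full] [G.Faithful] (q : Q ⥤ D) {a b : R}
    {f : a ⟶ b} (hf : IsCart q (G.map f)) : IsCart (G ⋙ q) f := by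
  rw [isCart_iff] at hf ⊢
  intro c h g hg
  obtain ⟨k, ⟨hk, hk'⟩, hu⟩ := hf (G.obj c) (G.map h) g hg
  refine ⟨G.preimage k, ⟨by simpa using hk, G.map_injective (by simpa using hk')⟩, ?_⟩
  rintro l ⟨hl, hl'⟩
  exact G.map_injective ((hu (G.map l) ⟨hl, by rw [← G.map_comp, hl']⟩).trans (by simp))

theorem IsCart.map_of_iso (q : Q ⥤ D) {G G' : R ⥤ Q} (i : G ≅ G') {a b : R} {f : a ⟶ b}
    (hf : IsCart q (G.map f)) : IsCart q (G'.map f) := by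
  have : G'.map f = i.inv.app a ≫ G.map f ≫ i.hom.app b := by simp
  rw [this]
  exact (isCart_of_isIso q _).comp (hf.comp (isCart_of_isIso q _))

/-- Two cartesian arrows with the same codomain over isomorphic arrows are isomorphic. -/
theorem IsCart.exists_isIso_comp {r : R ⥤ D} {a a' b : R} {f : a ⟶ b} {f' : a' ⟶ b}
    (hf : IsCart r f) (hf' : IsCart r f') (t : r.obj a ⟶ r.obj a') [IsIso t]
    (h : t ≫ r.map f' = r.map f) : ∃ k : a ⟶ a', IsIso k ∧ k ≫ f' = f := by
  obtain ⟨k, ⟨hk, hk'⟩, -⟩ := (isCart_iff _ _).1 hf' a f t h.symm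
  have h₁ : IsCart r k := IsCart.of_comp hf' (hk' ▸ hf)
  have : IsIso (r.map k) := hk ▸ inferInstance
  exact ⟨k, h₁.isIso, hk'⟩

end

section

variable {P : Type u₁} [Category.{v₁} P] {D : Type u₂} [Category.{v₂} D] {H : P ⥤ D}
  {W : MorphismProperty P} {R : Type u₅} [Category.{v₅} R] (K : Comma (𝟭 D) H ⥤ R) {r : R ⥤ D}
  (e : K ⋙ r ≅ Comma.fst (𝟭 D) H)

theorem isCart_of_isIso_right {A B : Comma (𝟭 D) H} (f : A ⟶ B) [IsIso f.right] :
    IsCart (Comma.fst (𝟭 D) H) f := by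
  rw [isCart_iff]
  intro c h g hg
  have hl : h.left = g ≫ f.left := hg
  have hw : h.left ≫ B.hom = c.hom ≫ H.map h.right := h.w
  have fw : f.left ≫ B.hom = A.hom ≫ H.map f.right := f.w
  refine ⟨⟨g, h.right ≫ inv f.right, ?_⟩, ⟨rfl, Comma.hom_ext _ _ hl.symm ?_⟩, ?_⟩
  · rw [← cancel_mono (H.map f.right)]
    change (g ≫ A.hom) ≫ H.map f.right = (c.hom ≫ H.map (h.right ≫ inv f.right)) ≫ H.map f.right
    rw [Category.assoc, Category.assoc, ← fw, ← H.map_comp, Category.assoc, IsIso.inv_hom_id,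
      Category.comp_id, ← hw, hl, Category.assoc]
  · exact (Category.assoc _ _ _).trans ((congrArg (_ ≫ ·) (IsIso.inv_hom_id _)).trans
      (Category.comp_id _))
  · rintro k ⟨hk, hk'⟩
    refine Comma.hom_ext _ _ hk ?_
    rw [← cancel_mono f.right]
    refine (congrArg CommaMorphism.right hk').trans (Eq.symm ?_)
    exact (Category.assoc _ _ _).trans ((congrArg (_ ≫ ·) (IsIso.inv_hom_id _)).trans
      (Category.comp_id _))

theorem isCart_liftArrow {d d' : D} (y : d ⟶ d') {U : P} (x : d' ⟶ H.obj U) :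
    IsCart (Comma.fst (𝟭 D) H) (liftArrow H y x) :=
  have : IsIso (liftArrow H y x).right := inferInstanceAs (IsIso (𝟙 U))
  isCart_of_isIso_right _

/-- The component in `P` of a cartesian arrow of `(1_D ↓ H)` is invertible; in other words, such an
arrow is a `liftArrow` up to an isomorphism. -/
theorem IsCart.isIso_vertArrow {A B : Comma (𝟭 D) H} {f : A ⟶ B}
    (hf : IsCart (Comma.fst (𝟭 D) H) f) :
    IsIso (vertArrow H A.hom (f.left ≫ B.hom) f.right f.w.symm) := by
  have h₁ : IsCart (Comma.fst (𝟭 D) H) (vertArrow H A.hom (f.left ≫ B.hom) f.right f.w.symm) :=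
    IsCart.of_comp (isCart_liftArrow f.left B.hom) (by rwa [vertArrow_comp_liftArrow_eq])
  have : IsIso ((Comma.fst (𝟭 D) H).map
    (vertArrow H A.hom (f.left ≫ B.hom) f.right f.w.symm)) := inferInstanceAs (IsIso (𝟙 A.left))
  exact h₁.isIso

variable (W) [K.IsLocalization (vertW H W)]

include W e in
/-- Every localization of `(1_D ↓ H)` is equivalent to the total category of the fibrewise
localization, so it sends the arrows `(y, 1)` to cartesian arrows. -/
theorem isCart_map_liftArrow {d d' : D} (y : d ⟶ d') {U : P} (x : d' ⟶ H.obj U) :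
    IsCart r (K.map (liftArrow H y x)) := by
  let S := vertW H W
  let Ψ : R ≌ ∫ᶜ (locIndexed H W) := Localization.uniq K (toTotal H W) S
  let i : K ⋙ Ψ.functor ≅ toTotal H W := Localization.compUniqFunctor K (toTotal H W) S
  let κ : Ψ.functor ⋙ forget (locIndexed H W) ≅ r :=
    (Localization.fullyFaithfulWhiskeringLeft K S D).preimageIso
      (Functor.isoWhiskerRight i (forget (locIndexed H W)) ≪≫ e.symm)
  have h₁ : IsCart (forget (locIndexed H W)) ((toTotal H W).map (liftArrow H y x)) := by
    rw [toTotal_map_liftArrow]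
    exact isCart_cartArrow y _
  exact (isCart_comp_of_isCart_map Ψ.functor (forget (locIndexed H W))
    (IsCart.map_of_iso _ i.symm h₁)).of_iso κ

include W e in
theorem isCart_map_of_isCart {A B : Comma (𝟭 D) H} {f : A ⟶ B}
    (hf : IsCart (Comma.fst (𝟭 D) H) f) : IsCart r (K.map f) := by
  have := hf.isIso_vertArrow
  rw [← vertArrow_comp_liftArrow_eq f, K.map_comp]
  exact (isCart_of_isIso r _).comp (isCart_map_liftArrow W K e f.left B.hom)

include W e in
/-- Over every arrow into `r a` there is, up to isomorphism, a cartesian arrow which comes from an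
arrow `(y, 1)`. -/
theorem exists_liftArrow (a : R) {X : D} (y : X ⟶ r.obj a) :
    ∃ (d : D) (U : P) (x : d ⟶ H.obj U) (z : X ⟶ d) (i : K.obj ⟨d, U, x⟩ ≅ a),
      (e.app ⟨X, U, z ≫ x⟩).inv ≫ r.map (K.map (liftArrow H z x) ≫ i.hom) = y := by
  have := Localization.essSurj K (vertW H W)
  let A := K.objPreimage a
  let i : K.obj A ≅ a := K.objObjPreimageIso a
  refine ⟨A.left, A.right, A.hom, y ≫ r.map i.inv ≫ (e.app A).hom, i, ?_⟩
  have h₁ := e.inv.naturality (liftArrow H (y ≫ r.map i.inv ≫ (e.app A).hom) A.hom)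
  rw [r.map_comp]
  refine (Category.assoc _ _ _).symm.trans ((congrArg (· ≫ _) h₁.symm).trans ?_)
  change ((y ≫ r.map i.inv ≫ e.hom.app A) ≫ e.inv.app A) ≫ r.map i.hom = y
  simp [← r.map_comp]

include W e in
theorem isStreetFibration_of_isLocalization : IsStreetFibration r := by
  intro a X y
  obtain ⟨d, U, x, z, i, h⟩ := exists_liftArrow W K e a y
  exact ⟨_, K.map (liftArrow H z x) ≫ i.hom, (e.app ⟨X, U, z ≫ x⟩).symm,
    (isCart_map_liftArrow W K e z x).comp (isCart_of_isIso r _), h⟩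

include W e in
/-- A functor preserves cartesian arrows if it does so on the images of the arrows `(y, 1)`. -/
theorem isCart_map_of_liftArrow {Q : Type u₄} [Category.{v₄} Q] {q : Q ⥤ D} (G : R ⥤ Q)
    (hG : ∀ {d d' : D} (y : d ⟶ d') {U : P} (x : d' ⟶ H.obj U),
      IsCart q (G.map (K.map (liftArrow H y x)))) {a b : R} (f : a ⟶ b) (hf : IsCart r f) :
    IsCart q (G.map f) := by
  obtain ⟨d, U, x, z, i, h⟩ := exists_liftArrow W K e b (r.map f)
  obtain ⟨k, hk, hk'⟩ := hf.exists_isIso_comp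
    ((isCart_map_liftArrow W K e z x).comp (isCart_of_isIso r i.hom)) _ h
  rw [← hk', G.map_comp, G.map_comp]
  exact (isCart_of_isIso q _).comp ((hG z x).comp (isCart_of_isIso q _))

end

end

/-! ### Two-cells out of a localization of the generalized elements -/

section

variable {C : Type u₁} [Category.{v₁} C] {P : Type u₃} [Category.{v₃} P] {p : P ⥤ C}

/-- The factorization through a cartesian arrow. -/
def IsCart.lift {a b c : P} {f : a ⟶ b} (hf : IsCart p f) (h : c ⟶ b) (g : p.obj c ⟶ p.obj a)
    (hg : p.map h = g ≫ p.map f) : c ⟶ a :=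
  ((isCart_iff p f).1 hf c h g hg).choose

theorem IsCart.map_lift {a b c : P} {f : a ⟶ b} (hf : IsCart p f) (h : c ⟶ b)
    (g : p.obj c ⟶ p.obj a) (hg : p.map h = g ≫ p.map f) : p.map (hf.lift h g hg) = g :=
  ((isCart_iff p f).1 hf c h g hg).choose_spec.1.1

theorem IsCart.lift_comp {a b c : P} {f : a ⟶ b} (hf : IsCart p f) (h : c ⟶ b)
    (g : p.obj c ⟶ p.obj a) (hg : p.map h = g ≫ p.map f) : hf.lift h g hg ≫ f = h :=
  ((isCart_iff p f).1 hf c h g hg).choose_spec.1.2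

theorem IsCart.hom_ext {a b c : P} {f : a ⟶ b} (hf : IsCart p f) {k k' : c ⟶ a}
    (h : p.map k = p.map k') (h' : k ≫ f = k' ≫ f) : k = k' :=
  ((isCart_iff p f).1 hf c (k' ≫ f) (p.map k') (p.map_comp _ _)).unique ⟨h, h'⟩ ⟨rfl, rfl⟩

end

section

variable {C : Type u₁} [Category.{v₁} C] {D : Type u₂} [Category.{v₂} D] {P : Type u₃}
  [Category.{v₃} P] {Q : Type u₄} [Category.{v₄} Q] {R : Type u₅} [Category.{v₅} R]

/-- The arrow `(d, 1)` from a generalized element `d : D ⟶ F p U` to the one given by the identity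
of `F p U`. -/
def toIdElt (p : P ⥤ C) (F : C ⥤ D) (A : Comma (𝟭 D) (p ⋙ F)) : A ⟶ (idElt p F).obj A.right where
  left := A.hom
  right := 𝟙 A.right
  w := (Category.comp_id _).trans ((congrArg (_ ≫ ·) ((p ⋙ F).map_id _)).trans
    (Category.comp_id _)).symm

theorem comp_toIdElt (p : P ⥤ C) (F : C ⥤ D) {A B : Comma (𝟭 D) (p ⋙ F)} (f : A ⟶ B) :
    f ≫ toIdElt p F B = toIdElt p F A ≫ (idElt p F).map f.right :=
  Comma.hom_ext _ _ f.w ((Category.comp_id _).trans (Category.id_comp _).symm)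

variable {p : P ⥤ C} {F : C ⥤ D} (K : Comma (𝟭 D) (p ⋙ F) ⥤ R) [K.IsLocalization (vertCart p F)]
  {r : R ⥤ D} (e : K ⋙ r ≅ Comma.fst (𝟭 D) (p ⋙ F))

/-- The arrows of `P` which are cartesian for `p`. -/
def cartArrows (p : P ⥤ C) : MorphismProperty P := fun _ _ f => IsCart p f

/-- `vertCart p F` is the class `vertW` of the cartesian arrows of `p`. -/
instance isLocalization_vertW : K.IsLocalization (vertW (p ⋙ F) (cartArrows p)) :=
  inferInstanceAs (K.IsLocalization (vertCart p F))

include e in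
theorem isCart_map_toIdElt (A : Comma (𝟭 D) (p ⋙ F)) : IsCart r (K.map (toIdElt p F A)) :=
  have : IsIso (toIdElt p F A).right := inferInstanceAs (IsIso (𝟙 A.right))
  isCart_map_of_isCart (cartArrows p) K e (isCart_of_isIso_right _)

section TwoCells

variable {K e} {q : Q ⥤ D} {β β' : FibHom r q}
  (ν : ∀ U : P, β.functor.obj (K.obj ((idElt p F).obj U)) ⟶
    β'.functor.obj (K.obj ((idElt p F).obj U)))
  (hν : ∀ {U V : P} (α : U ⟶ V), β.functor.map (K.map ((idElt p F).map α)) ≫ ν V =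
    ν U ≫ β'.functor.map (K.map ((idElt p F).map α)))
  (hw : ∀ U : P, q.map (ν U) ≫ β'.iso.hom.app _ = β.iso.hom.app _)

include e in
theorem isCart_map_map_toIdElt (β : FibHom r q) (A : Comma (𝟭 D) (p ⋙ F)) :
    IsCart q (β.functor.map (K.map (toIdElt p F A))) :=
  β.preserves _ (isCart_map_toIdElt K e A)

include hw in
omit [K.IsLocalization (vertCart p F)] in
theorem map_toIdElt_comp_eq (A : Comma (𝟭 D) (p ⋙ F)) :
    q.map (β.functor.map (K.map (toIdElt p F A)) ≫ ν A.right) =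
      (β.iso.hom.app (K.obj A) ≫ β'.iso.inv.app (K.obj A)) ≫
        q.map (β'.functor.map (K.map (toIdElt p F A))) := by
  have h₁ := β.iso.hom.naturality (K.map (toIdElt p F A))
  have h₂ := β'.iso.inv.naturality (K.map (toIdElt p F A))
  dsimp at h₁ h₂
  rw [q.map_comp, Category.assoc, ← h₂, ← cancel_mono (β'.iso.hom.app _), Category.assoc, hw, h₁]
  simp only [Category.assoc, Iso.inv_hom_id_app, Category.comp_id]

variable (e) in
/-- The extension to `(1_D ↓ F ∘ p)` of a family `ν`, indexed by `P`, of arrows compatible with the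
structural isomorphisms over `D`: the component at a generalized element `A` is the factorization of
`ν` through the cartesian image of `toIdElt p F A`. -/
def extendApp (A : Comma (𝟭 D) (p ⋙ F)) :
    β.functor.obj (K.obj A) ⟶ β'.functor.obj (K.obj A) :=
  (isCart_map_map_toIdElt (e := e) β' A).lift _ _ (map_toIdElt_comp_eq ν hw A)

theorem map_extendApp (A : Comma (𝟭 D) (p ⋙ F)) :
    q.map (extendApp e ν hw A) = β.iso.hom.app (K.obj A) ≫ β'.iso.inv.app (K.obj A) :=
  IsCart.map_lift _ _ _ _

theorem extendApp_comp (A : Comma (𝟭 D) (p ⋙ F)) :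
    extendApp e ν hw A ≫ β'.functor.map (K.map (toIdElt p F A)) =
      β.functor.map (K.map (toIdElt p F A)) ≫ ν A.right :=
  IsCart.lift_comp _ _ _ _

theorem extendApp_idElt (U : P) : extendApp e ν hw ((idElt p F).obj U) = ν U := by
  have h : ∀ G : R ⥤ Q, G.map (K.map (toIdElt p F ((idElt p F).obj U))) = 𝟙 _ := fun G =>
    (congrArg G.map (K.map_id _)).trans (G.map_id _)
  exact (Category.comp_id _).symm.trans ((congrArg (_ ≫ ·) (h β'.functor).symm).trans
    ((extendApp_comp (e := e) ν hw ((idElt p F).obj U)).trans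
      ((congrArg (· ≫ _) (h β.functor)).trans (Category.id_comp _))))

include hν in
theorem extendApp_naturality {A B : Comma (𝟭 D) (p ⋙ F)} (f : A ⟶ B) :
    β.functor.map (K.map f) ≫ extendApp e ν hw B =
      extendApp e ν hw A ≫ β'.functor.map (K.map f) := by
  refine (isCart_map_map_toIdElt (e := e) β' B).hom_ext ?_ ?_
  · have h₁ := β.iso.hom.naturality (K.map f)
    have h₂ := β'.iso.inv.naturality (K.map f)
    dsimp at h₁ h₂
    rw [q.map_comp, q.map_comp, map_extendApp, map_extendApp, reassoc_of% h₁, Category.assoc, h₂]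
  · rw [Category.assoc, extendApp_comp, Category.assoc, ← β'.functor.map_comp, ← K.map_comp,
      comp_toIdElt, K.map_comp, β'.functor.map_comp, ← Category.assoc (extendApp e ν hw A),
      extendApp_comp, Category.assoc, ← hν, ← Category.assoc, ← Category.assoc,
      ← β.functor.map_comp, ← β.functor.map_comp, ← K.map_comp, ← K.map_comp, comp_toIdElt]

/-- Every 2-cell between the restrictions along the unit of two morphisms out of the localization
extends to a 2-cell between these morphisms. -/
theorem exists_hom_extending (hν : ∀ {U V : P} (α : U ⟶ V),
    β.functor.map (K.map ((idElt p F).map α)) ≫ ν V =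
      ν U ≫ β'.functor.map (K.map ((idElt p F).map α)))
    (hw : ∀ U : P, q.map (ν U) ≫ β'.iso.hom.app _ = β.iso.hom.app _)
    (e : K ⋙ r ≅ Comma.fst (𝟭 D) (p ⋙ F)) :
    ∃ m : β ⟶ β', ∀ U : P, m.nat.app (K.obj ((idElt p F).obj U)) = ν U := by
  let τ : K ⋙ β.functor ⟶ K ⋙ β'.functor :=
    { app := extendApp e ν hw
      naturality := fun _ _ f => extendApp_naturality ν hν hw f }
  let fW := Localization.fullyFaithfulWhiskeringLeft K (vertCart p F) Q
  let σ : β.functor ⟶ β'.functor := fW.preimage τ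
  have hσ : ∀ A, σ.app (K.obj A) = extendApp e ν hw A := fun A =>
    congrArg (fun t => t.app A) (fW.map_preimage τ)
  refine ⟨⟨σ, fun a => ?_⟩, fun U => (hσ _).trans (extendApp_idElt ν hw U)⟩
  have := Localization.essSurj K (vertCart p F)
  let i := K.objObjPreimageIso a
  have h₁ := β.iso.hom.naturality i.hom
  have h₂ := β'.iso.hom.naturality i.hom
  have h₃ := σ.naturality i.hom
  dsimp at h₁ h₂ h₃
  rw [← cancel_epi (q.map (β.functor.map i.hom)), h₁, ← q.map_comp_assoc, h₃, q.map_comp_assoc,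
    h₂, hσ, map_extendApp]
  simp

/-- A 2-cell between morphisms out of the localization is determined by its restriction along the
unit. -/
theorem hom_ext_of_idElt (e : K ⋙ r ≅ Comma.fst (𝟭 D) (p ⋙ F)) {m m' : β ⟶ β'}
    (h : ∀ U : P, m.nat.app (K.obj ((idElt p F).obj U)) =
      m'.nat.app (K.obj ((idElt p F).obj U))) : m = m' := by
  refine FibHom.Hom.ext (Localization.natTrans_ext K (vertCart p F) fun A => ?_)
  refine (isCart_map_map_toIdElt (e := e) β' A).hom_ext ?_ ?_
  · rw [← cancel_mono (β'.iso.hom.app _), m.w, m'.w]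
  · rw [← m.nat.naturality, ← m'.nat.naturality, h]

end TwoCells

end

/-! ### Extension of morphisms of fibrations -/

section

variable {C : Type u₁} [Category.{v₁} C] {D : Type u₂} [Category.{v₂} D] {P : Type u₃}
  [Category.{v₃} P] {Q : Type u₄} [Category.{v₄} Q] {R : Type u₅} [Category.{v₅} R]

/-- An isomorphism of morphisms of fibrations from one of the underlying functors. -/
def FibHom.isoMk {p : P ⥤ C} {q : Q ⥤ C} {G H : FibHom p q} (i : G.functor ≅ H.functor)
    (w : ∀ a : P, q.map (i.hom.app a) ≫ H.iso.hom.app a = G.iso.hom.app a) : G ≅ H where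
  hom := ⟨i.hom, w⟩
  inv := ⟨i.inv, fun a => by rw [← w a, ← q.map_comp_assoc]; simp⟩
  hom_inv_id := FibHom.Hom.ext i.hom_inv_id
  inv_hom_id := FibHom.Hom.ext i.inv_hom_id

variable {p : P ⥤ C} {F : C ⥤ D} (K : Comma (𝟭 D) (p ⋙ F) ⥤ R) [K.IsLocalization (vertCart p F)]
  {r : R ⥤ D} (e : K ⋙ r ≅ Comma.fst (𝟭 D) (p ⋙ F)) {q : Q ⥤ D}

/-- A functor `B` over `D` out of `(1_D ↓ F ∘ p)` which inverts `vertCart p F` and sends the arrows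
`(y, 1)` to cartesian arrows descends to a morphism of fibrations out of the localization. -/
theorem exists_fibHom_extending (B : Comma (𝟭 D) (p ⋙ F) ⥤ Q)
    (hB : (vertCart p F).IsInvertedBy B) (b : B ⋙ q ≅ Comma.fst (𝟭 D) (p ⋙ F))
    (hc : ∀ {d d' : D} (y : d ⟶ d') {U : P} (x : d' ⟶ (p ⋙ F).obj U),
      IsCart q (B.map (liftArrow (p ⋙ F) y x))) :
    ∃ (β : FibHom r q) (δ : K ⋙ β.functor ≅ B), ∀ A, β.iso.hom.app (K.obj A) =
      q.map (δ.hom.app A) ≫ b.hom.app A ≫ e.inv.app A := by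
  let G : R ⥤ Q := Localization.lift B hB K
  let δ : K ⋙ G ≅ B := Localization.fac B hB K
  let j : K ⋙ G ⋙ q ≅ K ⋙ r := Functor.isoWhiskerRight δ q ≪≫ b ≪≫ e.symm
  let fW := Localization.fullyFaithfulWhiskeringLeft K (vertCart p F) D
  have hj : ∀ A, (fW.preimageIso j).hom.app (K.obj A) = j.hom.app A := fun A =>
    congrArg (fun t => t.app A) (fW.map_preimage j.hom)
  refine ⟨⟨G, fW.preimageIso j, ?_⟩, δ, hj⟩
  intro _ _ f hf
  exact isCart_map_of_liftArrow (cartArrows p) K e G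
    (fun y _ x => IsCart.map_of_iso q δ.symm (hc y x)) f hf

section Lift

variable (hq : IsStreetFibration q) (γ : FibHom p (CategoricalPullback.π₁ F q))

/-- The structural isomorphism over `C` of a morphism into a pseudopullback. -/
def baseIso (U : P) : p.obj U ≅ (γ.functor.obj U).fst :=
  (γ.iso.app U).symm

theorem baseIso_naturality {U V : P} (α : U ⟶ V) :
    p.map α ≫ (baseIso γ V).hom = (baseIso γ U).hom ≫ (γ.functor.map α).fst :=
  γ.iso.inv.naturality α

/-- The arrow of `D` corresponding to a generalized element `d : A ⟶ F p U` under the isomorphism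
of `F p U` with the image of the `Q`-component of `γ U`. -/
def targetArrow (A : Comma (𝟭 D) (p ⋙ F)) : A.left ⟶ q.obj (γ.functor.obj A.right).snd :=
  A.hom ≫ F.map (baseIso γ A.right).hom ≫ (γ.functor.obj A.right).iso.hom

theorem targetArrow_naturality {A B : Comma (𝟭 D) (p ⋙ F)} (f : A ⟶ B) :
    targetArrow γ A ≫ q.map (γ.functor.map f.right).snd = f.left ≫ targetArrow γ B := by
  have h₁ : f.left ≫ B.hom = A.hom ≫ F.map (p.map f.right) := f.w
  simp only [targetArrow, Category.assoc]
  rw [← (γ.functor.map f.right).w, ← F.map_comp_assoc, ← baseIso_naturality, F.map_comp_assoc]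
  exact (Category.assoc _ _ _).symm.trans
    ((congrArg (· ≫ _) h₁.symm).trans (Category.assoc _ _ _))

/-- The domain of a chosen cartesian lift of `targetArrow`. -/
def liftObj (A : Comma (𝟭 D) (p ⋙ F)) : Q :=
  (hq _ _ (targetArrow γ A)).choose

/-- A chosen cartesian lift of `targetArrow`. -/
def liftHom (A : Comma (𝟭 D) (p ⋙ F)) : liftObj hq γ A ⟶ (γ.functor.obj A.right).snd :=
  (hq _ _ (targetArrow γ A)).choose_spec.choose

/-- The comparison isomorphism of a chosen cartesian lift of `targetArrow`. -/
def liftObjIso (A : Comma (𝟭 D) (p ⋙ F)) : A.left ≅ q.obj (liftObj hq γ A) :=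
  (hq _ _ (targetArrow γ A)).choose_spec.choose_spec.choose

theorem isCart_liftHom (A : Comma (𝟭 D) (p ⋙ F)) : IsCart q (liftHom hq γ A) :=
  (hq _ _ (targetArrow γ A)).choose_spec.choose_spec.choose_spec.1

theorem liftObjIso_comp (A : Comma (𝟭 D) (p ⋙ F)) :
    (liftObjIso hq γ A).hom ≫ q.map (liftHom hq γ A) = targetArrow γ A :=
  (hq _ _ (targetArrow γ A)).choose_spec.choose_spec.choose_spec.2

theorem map_liftHom_comp {A B : Comma (𝟭 D) (p ⋙ F)} (f : A ⟶ B) :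
    q.map (liftHom hq γ A ≫ (γ.functor.map f.right).snd) =
      ((liftObjIso hq γ A).inv ≫ f.left ≫ (liftObjIso hq γ B).hom) ≫ q.map (liftHom hq γ B) := by
  rw [Category.assoc, Category.assoc, liftObjIso_comp, ← targetArrow_naturality,
    ← liftObjIso_comp hq γ A, q.map_comp]
  simp

/-- The action on arrows of the chosen cartesian lifts. -/
def liftMap {A B : Comma (𝟭 D) (p ⋙ F)} (f : A ⟶ B) : liftObj hq γ A ⟶ liftObj hq γ B :=
  (isCart_liftHom hq γ B).lift _ _ (map_liftHom_comp hq γ f)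

theorem map_liftMap {A B : Comma (𝟭 D) (p ⋙ F)} (f : A ⟶ B) :
    q.map (liftMap hq γ f) = (liftObjIso hq γ A).inv ≫ f.left ≫ (liftObjIso hq γ B).hom :=
  IsCart.map_lift _ _ _ _

theorem liftMap_comp_liftHom {A B : Comma (𝟭 D) (p ⋙ F)} (f : A ⟶ B) :
    liftMap hq γ f ≫ liftHom hq γ B = liftHom hq γ A ≫ (γ.functor.map f.right).snd :=
  IsCart.lift_comp _ _ _ _

/-- The functor from `(1_D ↓ F ∘ p)` to `Q` which sends `d : A ⟶ F p U` to the reindexing along `d`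
of the `Q`-component of `γ U`. -/
def liftFunctor : Comma (𝟭 D) (p ⋙ F) ⥤ Q where
  obj A := liftObj hq γ A
  map f := liftMap hq γ f
  map_id A := (isCart_liftHom hq γ A).hom_ext (by simp [map_liftMap])
    (by simp [liftMap_comp_liftHom])
  map_comp {A B Z} f g := (isCart_liftHom hq γ Z).hom_ext (by simp [map_liftMap])
    (by
      rw [Category.assoc, liftMap_comp_liftHom, liftMap_comp_liftHom, ← Category.assoc,
        liftMap_comp_liftHom]
      simp)

theorem isCart_liftMap {A B : Comma (𝟭 D) (p ⋙ F)} (f : A ⟶ B) (hf : IsCart p f.right) :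
    IsCart q (liftMap hq γ f) := by
  refine IsCart.of_comp (isCart_liftHom hq γ B) ?_
  rw [liftMap_comp_liftHom]
  exact (isCart_liftHom hq γ A).comp (isCart_snd F hq _ (γ.preserves _ hf))

theorem liftFunctor_isInvertedBy : (vertCart p F).IsInvertedBy (liftFunctor hq γ) := by
  intro A B f hf
  have h₁ : IsIso f.left := hf.1
  have h₂ : IsIso (q.map (liftMap hq γ f)) := by
    rw [map_liftMap]
    infer_instance
  exact (isCart_liftMap hq γ f hf.2).isIso

/-- `liftFunctor` lies over `D`. -/
def liftFunctorIso : liftFunctor hq γ ⋙ q ≅ Comma.fst (𝟭 D) (p ⋙ F) :=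
  NatIso.ofComponents (fun A => (liftObjIso hq γ A).symm) (fun f => by
    refine (congrArg (· ≫ _) (map_liftMap hq γ f)).trans ?_
    simp
    rfl)

theorem isIso_liftHom_idElt (U : P) : IsIso (liftHom hq γ ((idElt p F).obj U)) := by
  have h := liftObjIso_comp hq γ ((idElt p F).obj U)
  have : IsIso (targetArrow γ ((idElt p F).obj U)) :=
    inferInstanceAs
      (IsIso (𝟙 (F.obj (p.obj U)) ≫ F.map (baseIso γ U).hom ≫ (γ.functor.obj U).iso.hom))
  have : IsIso (q.map (liftHom hq γ ((idElt p F).obj U))) := by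
    rw [← h] at this
    exact IsIso.of_isIso_comp_left (liftObjIso hq γ ((idElt p F).obj U)).hom _
  exact (isCart_liftHom hq γ _).isIso

end Lift

include e in
/-- An arrow of `(1_D ↓ F ∘ p)` with cartesian component in `P` is an arrow of `vertCart p F`
followed by an arrow `(y, 1)`, so it becomes cartesian in the localization. -/
theorem isCart_map_of_isCart_right {A B : Comma (𝟭 D) (p ⋙ F)} (f : A ⟶ B)
    (hf : IsCart p f.right) : IsCart r (K.map f) := by
  have h₁ : IsIso (K.map (vertArrow (p ⋙ F) A.hom (f.left ≫ B.hom) f.right f.w.symm)) :=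
    Localization.inverts K (vertCart p F) _ ⟨inferInstanceAs (IsIso (𝟙 A.left)), hf⟩
  rw [← vertArrow_comp_liftArrow_eq f, K.map_comp]
  exact (isCart_of_isIso r _).comp (isCart_map_liftArrow (cartArrows p) K e f.left B.hom)

theorem isCart_unitFunctor_map {U V : P} (α : U ⟶ V) (hα : IsCart p α) :
    IsCart (CategoricalPullback.π₁ F r) ((unitFunctor p F K r e).map α) :=
  isCart_of_snd F r _ (isCart_map_of_isCart_right K e ((idElt p F).map α) hα)

end

/-! ### The universal property for fibrations -/

section

variable {A : Type u₁} [Category.{v₁} A]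

theorem comp_hom_eq_hom {x y z z' : A} {f : x ⟶ x} (hf : f = 𝟙 x) (i : x ≅ y) (b' : z' ≅ y)
    (b : z ≅ y) {t : z ⟶ z'} (h : f ≫ i.hom ≫ b'.inv = (i.hom ≫ b.inv) ≫ t) :
    t ≫ b'.hom = b.hom := by
  rw [hf, Category.id_comp, Category.assoc, cancel_epi] at h
  rw [← cancel_epi b.inv, ← Category.assoc, ← h, Iso.inv_hom_id, Iso.inv_hom_id]

theorem eq_inv_comp_inv_comp {x y z z' w : A} (i : y ≅ x) (b : z ≅ y) (l : x ≅ z') (d : z ≅ z')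
    (hb : b.hom = d.hom ≫ l.inv ≫ i.inv) {t : z' ⟶ w} {s : x ⟶ w} (h : l.hom ≫ t = 𝟙 x ≫ s) :
    s = (i.inv ≫ b.inv) ≫ d.hom ≫ t := by
  have hb' : b = d ≪≫ l.symm ≪≫ i.symm := Iso.ext hb
  rw [hb', ← Category.id_comp s, ← h]
  simp

end

section

variable {C : Type u₁} [Category.{v₁} C] {D : Type u₂} [Category.{v₂} D] {P : Type u₃}
  [Category.{v₃} P] {Q : Type u₄} [Category.{v₄} Q] {R : Type u₅} [Category.{v₅} R]
  {p : P ⥤ C} {F : C ⥤ D} (K : Comma (𝟭 D) (p ⋙ F) ⥤ R) [K.IsLocalization (vertCart p F)]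
  {r : R ⥤ D} (e : K ⋙ r ≅ Comma.fst (𝟭 D) (p ⋙ F))

/-- The unit of the inverse image of fibrations. -/
def fibredUnit : FibHom p (CategoricalPullback.π₁ F r) :=
  ⟨unitFunctor p F K r e, unitIso p F K r e, fun α hα => isCart_unitFunctor_map K e α hα⟩

variable {q : Q ⥤ D} (hr : IsStreetFibration r)

variable (q) in
/-- The functor `β ↦ F^*(β) ∘ η`. -/
abbrev transposition : FibHom r q ⥤ FibHom p (CategoricalPullback.π₁ F q) :=
  directImageFunctor F hr q ⋙ (fibredUnit K e).precomp (CategoricalPullback.π₁ F q)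

theorem transposition_faithful : (transposition K e q hr).Faithful where
  map_injective h := hom_ext_of_idElt e fun U => congrArg (fun m => (m.nat.app U).snd) h

theorem transposition_full : (transposition K e q hr).Full where
  map_surjective {β β'} n := by
    have h₀ : ∀ U, (n.nat.app U).fst = 𝟙 _ := fun U => by
      have h₁ := n.w U
      have h₂ : ∀ b : FibHom r q, ((transposition K e q hr).obj b).iso.hom.app U = 𝟙 (p.obj U) :=
        fun b => (Category.id_comp _).trans (Category.id_comp _)
      exact (Category.comp_id _).symm.trans
        ((congrArg (_ ≫ ·) (h₂ β').symm).trans (h₁.trans (h₂ β)))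
    obtain ⟨m, hm⟩ := exists_hom_extending (K := K) (fun U => (n.nat.app U).snd)
      (fun α => congrArg (fun t => t.snd) (n.nat.naturality α)) (fun U => by
        have h₂ : F.map (n.nat.app U).fst = 𝟙 (F.obj (p.obj U)) :=
          (congrArg F.map (h₀ U)).trans (F.map_id _)
        exact comp_hom_eq_hom h₂ (e.app ((idElt p F).obj U)).symm (β'.iso.app _) (β.iso.app _)
          (n.nat.app U).w) e
    refine ⟨m, FibHom.Hom.ext (NatTrans.ext (funext fun U => ?_))⟩
    exact CategoricalPullback.hom_ext (h₀ U).symm (hm U)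

variable {K e} in
theorem transposition_essSurj (hq : IsStreetFibration q) : (transposition K e q hr).EssSurj where
  mem_essImage γ := by
    obtain ⟨β, δ, hβ⟩ := exists_fibHom_extending K e (liftFunctor hq γ)
      (liftFunctor_isInvertedBy hq γ) (liftFunctorIso hq γ)
      (fun y U x => isCart_liftMap hq γ _ (isCart_of_isIso p (𝟙 U)))
    let i : ∀ U : P, β.functor.obj (K.obj ((idElt p F).obj U)) ≅ (γ.functor.obj U).snd :=
      fun U => δ.app _ ≪≫ @asIso _ _ _ _ (liftHom hq γ ((idElt p F).obj U))
        (isIso_liftHom_idElt hq γ U)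
    refine ⟨β, ⟨FibHom.isoMk (NatIso.ofComponents (fun U =>
      CategoricalPullback.mkIso (baseIso γ U) (i U) ?_) ?_) ?_⟩⟩
    · let A := (idElt p F).obj U
      exact (eq_inv_comp_inv_comp (e.app A) (β.iso.app (K.obj A)) (liftObjIso hq γ A)
        (q.mapIso (δ.app A)) (hβ A) (liftObjIso_comp hq γ A)).trans
          (congrArg (_ ≫ ·) (q.map_comp _ _).symm)
    · intro U V α
      refine CategoricalPullback.hom_ext ?_ ?_
      · exact baseIso_naturality γ α
      · have h₁ := δ.hom.naturality ((idElt p F).map α)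
        have h₂ := liftMap_comp_liftHom hq γ ((idElt p F).map α)
        refine (Category.assoc _ _ _).symm.trans ((congrArg (· ≫ _) h₁).trans ?_)
        refine (Category.assoc _ _ _).trans ((congrArg (_ ≫ ·) h₂).trans ?_)
        exact (Category.assoc _ _ _).symm
    · intro U
      exact (γ.iso.inv_hom_id_app U).trans
        ((Category.id_comp _).trans (Category.id_comp _)).symm

end

end InverseImage

end

theorem proposition3p3p1 {C : Type u₁} [Category.{v₁} C] {D : Type u₂} [Category.{v₂} D]
    (F : C ⥤ D) :
    (∀ E : LocallyDiscrete Cᵒᵖ ⥤ᵖ Cat.{max w u₁ v₁ v₂, max w u₁ v₁ v₂},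
      (∃ (L : LocallyDiscrete Dᵒᵖ ⥤ᵖ Cat.{max w u₁ v₁ v₂, max w u₁ v₁ v₂})
          (η : E ⟶ InverseImage.restrict F L), InverseImage.IsIndexedInverseImage F E L η) ∧
        ∀ (L : LocallyDiscrete Dᵒᵖ ⥤ᵖ Cat.{max w u₁ v₁ v₂, max w u₁ v₁ v₂})
          (η : E ⟶ InverseImage.restrict F L), InverseImage.IsIndexedInverseImage F E L η →
          ∀ d : D, (InverseImage.fibreComparison F η d).IsLocalization
            (InverseImage.fibreCart F E d)) ∧
    (∀ {P : Type u₃} [Category.{v₃} P] (p : P ⥤ C), InverseImage.IsStreetFibration p →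
      (InverseImage.vertCart p F).IsInvertedBy (Comma.fst (𝟭 D) (p ⋙ F)) ∧
      ∀ {R : Type u₅} [Category.{v₅} R] (K : Comma (𝟭 D) (p ⋙ F) ⥤ R)
        [K.IsLocalization (InverseImage.vertCart p F)] (r : R ⥤ D)
        (e : K ⋙ r ≅ Comma.fst (𝟭 D) (p ⋙ F)),
        (∀ {a b : Comma (𝟭 D) (p ⋙ F)} (f : a ⟶ b),
          InverseImage.IsCart (Comma.fst (𝟭 D) (p ⋙ F)) f → InverseImage.IsCart r (K.map f)) ∧
        ∃ (hr : InverseImage.IsStreetFibration r)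
          (hη : ∀ {U V : P} (α : U ⟶ V), InverseImage.IsCart p α →
            InverseImage.IsCart (CategoricalPullback.π₁ F r)
              ((InverseImage.unitFunctor p F K r e).map α)),
          InverseImage.IsFibredInverseImage.{v₁, v₂, v₃, v₄, v₅, u₁, u₂, u₃, u₄, u₅} F hr
            ⟨InverseImage.unitFunctor p F K r e, InverseImage.unitIso p F K r e, hη⟩) := by
  refine ⟨fun E => ⟨⟨_, _, InverseImage.isIndexedInverseImage_lan F E⟩,
    fun L η hη d => hη.isLocalization d⟩, fun p _ => ⟨fun _ _ _ hf => hf.1, ?_⟩⟩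
  intro R _ K _ r e
  refine ⟨fun f hf => InverseImage.isCart_map_of_isCart (InverseImage.cartArrows p) K e hf,
    InverseImage.isStreetFibration_of_isLocalization (InverseImage.cartArrows p) K e,
    fun α hα => InverseImage.isCart_unitFunctor_map K e α hα, ?_⟩
  intro Q _ q hq
  exact { faithful := InverseImage.transposition_faithful K e _
          full := InverseImage.transposition_full K e _
          essSurj := InverseImage.transposition_essSurj _ hq }
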